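/- For $m\in\mathbb R^2$ and $r\in\mathbb R$ let $h_{m,r}:\mathbb R^2\to\{0,1\}$ be the indicator function of $\{x:|x-m|\le r\}$, and for $v=(m_1,r_1,\dots,m_n,r_n)\in\mathbb R^{3n}$ ($n\ge 0$) let $H_n(v):=\sum_{i=1}^n h_{m_i,r_i}|_{S^1}$, a function from the unit circle $S^1\subset\mathbb R^2$ to $\mathbb N=\{0,1,2,\dots\}$. For a function $g:S^1\to\mathbb N$ with finitely many discontinuities let $\mathrm{seq}(g)$ be the list of values of $g$ on the arcs between consecutive discontinuity points, in counterclockwise order, up to cyclic shifts (the one-term list consisting of the value of $g$ if $g$ is constant). Call $H_n(v)$ robust if there is $\bar\varepsilon>0$ such that $\mathrm{seq}(H_n(v+\varepsilon u))=\mathrm{seq}(H_n(v))$ for all $\varepsilon\in(0,\bar\varepsilon)$ and all $u\in\mathbb R^{3n}$ with Euclidean norm $|u|=1$. Let $f:S^1\to\mathbb N$ have finitely many discontinuities, and let $\bar f$ be the class of all functions $S^1\to\mathbb N$ that differ from $f$ at only finitely many points. Let $\langle\bar f\rangle\in\bar f$ be the canonical representative $\langle\bar f\rangle(x):=\max(f(x^+),f(x^-))$,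 where $f(x^\pm)$ are the one-sided limits along $S^1$, and put $$\bar f^*:=\max_{S^1}\langle\bar f\rangle,\qquad \bar f_*:=\min_{S^1}\langle\bar f\rangle,\qquad \tau:=\sum_{k=\bar f_*+1}^{\bar f^*}\bigl(\#\{\text{connected components of }\langle\bar f\rangle^{-1}([k,\infty))\}-1\bigr).$$ **Proposition.** Suppose that some robust $H_n(v)\in\bar f$ exists and that $\bar f_*\ge\tau$. Then there are exactly $(\bar f^*-\bar f_*+\tau)!$ distinct robust decompositions $H_n(v)\in\bar f$ (over all $n$ and $v$), where a decomposition is regarded as the multiset of the restrictions $h_{m_i,r_i}|_{S^1}$ that are not identically $0$; that is, the order of the signals is irrelevant, signals vanishing on $S^1$ are ignored, and data $(m_i,r_i)$ giving the same function on $S^1$ are not distinguished. -/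

import Mathlib

/-! The plane is `ℂ` (Euclidean norm), `S¹` is `Circle`. One signal is given by its centre and
radius `(m, r) : ℂ × ℝ`; a data vector in `ℝ^{3n}` is a map `Fin n → ℂ × ℝ`. -/

namespace CircleDecomp

/-- The signal function on the plane: the indicator of the closed disk with centre `p.1` and
radius `p.2`. -/
noncomputable def signal (p : ℂ × ℝ) (x : ℂ) : ℕ :=
  if ‖x - p.1‖ ≤ p.2 then 1 else 0

/-- The restriction of a signal function to the unit circle. -/
noncomputable def circleSignal (p : ℂ × ℝ) (x : Circle) : ℕ :=
  signal p (x : ℂ)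

/-- `H_n(v)`: the sum of the `n` signal functions, on the circle. -/
noncomputable def totalSignal {n : ℕ} (v : Fin n → ℂ × ℝ) (x : Circle) : ℕ :=
  ∑ i, circleSignal (v i) x

/-- Piecewise constant functions on the circle: only finitely many discontinuities
(`ℕ` is discrete, so such a function is constant between consecutive discontinuities). -/
def PiecewiseConst (f : Circle → ℕ) : Prop :=
  {x : Circle | ¬ ContinuousAt f x}.Finite

/-- The class `f̄` of all functions that disagree with `f` at only finitely many points. -/
def modFinite (f : Circle → ℕ) : Set (Circle → ℕ) :=
  {g | {x : Circle | g x ≠ f x}.Finite}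

/-- The angles in `[0, 2π)` of the discontinuity points of `f`. -/
def discAngles (f : Circle → ℕ) : Set ℝ :=
  {t | t ∈ Set.Ico 0 (2 * Real.pi) ∧ ¬ ContinuousAt f (Circle.exp t)}

/-- The values of `f` at the midpoints of the arcs between cyclically consecutive angles of an
increasing list of angles in `[0, 2π)`; for the empty list, the single value `f 1`. -/
noncomputable def arcValues (f : Circle → ℕ) : List ℝ → List ℕ
  | [] => [f 1]
  | a :: l =>
    List.zipWith (fun s t => f (Circle.exp ((s + t) / 2))) (a :: l) (l ++ [a + 2 * Real.pi])

open Classical in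
/-- The sequence representation of a piecewise constant function: the values between consecutive
discontinuity points in counterclockwise order, as a list up to cyclic shifts
(a dummy value if there are infinitely many discontinuities). -/
noncomputable def seqRep (f : Circle → ℕ) : Cycle ℕ :=
  if h : (discAngles f).Finite then
    ((arcValues f (h.toFinset.sort (· ≤ ·)) : List ℕ) : Cycle ℕ)
  else Cycle.nil

/-- Robustness of `H_n(v)`: all sufficiently small perturbations of the data, in the Euclidean norm
of `ℝ^{3n}`, leave the sequence representation unchanged. -/
def Robust {n : ℕ} (v : Fin n → ℂ × ℝ) : Prop :=
  ∃ δ : ℝ, 0 < δ ∧ ∀ ε ∈ Set.Ioo (0 : ℝ) δ, ∀ u : Fin n → ℂ × ℝ,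
    Real.sqrt (∑ i, (‖(u i).1‖ ^ 2 + (u i).2 ^ 2)) = 1 →
      seqRep (totalSignal (v + ε • u)) = seqRep (totalSignal v)

/-- The counterclockwise limit `f(x⁺)`. -/
noncomputable def limPlus (f : Circle → ℕ) (x : Circle) : ℕ :=
  Function.rightLim (fun t : ℝ => f (x * Circle.exp t)) 0

/-- The clockwise limit `f(x⁻)`. -/
noncomputable def limMinus (f : Circle → ℕ) (x : Circle) : ℕ :=
  Function.leftLim (fun t : ℝ => f (x * Circle.exp t)) 0

/-- The canonical representative `⟨f̄⟩`: the properly upper semicontinuous function in the class of a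
piecewise constant `f`. -/
noncomputable def canon (f : Circle → ℕ) (x : Circle) : ℕ :=
  max (limPlus f x) (limMinus f x)

/-- `f̄^*`, the maximum of the canonical representative (which takes finitely many values). -/
noncomputable def upper (f : Circle → ℕ) : ℕ := sSup (Set.range (canon f))

/-- `f̄_*`, the minimum of the canonical representative. -/
noncomputable def lower (f : Circle → ℕ) : ℕ := sInf (Set.range (canon f))

/-- `τ(f̄)`: the sum over the levels `f̄_* < k ≤ f̄^*` of the number of connected components of the
(nonempty) set where the canonical representative is at least `k`, minus one. -/
noncomputable def tau (f : Circle → ℕ) : ℕ :=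
  ∑ k ∈ Finset.Icc (lower f + 1) (upper f),
    (Nat.card (ConnectedComponents {x : Circle // k ≤ canon f x}) - 1)

open Classical in
/-- The decomposition, as a collection of signals seen on the circle: the multiset of the
restrictions to the circle of the signal functions, without the inactive ones (those that vanish
identically on the circle). -/
noncomputable def activeSignals {n : ℕ} (v : Fin n → ℂ × ℝ) : Multiset (Circle → ℕ) :=
  (Finset.univ.val.map fun i => circleSignal (v i)).filter (fun g => g ≠ 0)

/-- The robust decompositions in `f̄`, two of them being identified when they consist of the same
active signals on the circle with the same multiplicities. -/
def robustDecomps (f : Circle → ℕ) : Set (Multiset (Circle → ℕ)) :=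
  {M | ∃ (n : ℕ) (v : Fin n → ℂ × ℝ),
    totalSignal v ∈ modFinite f ∧ Robust v ∧ activeSignals v = M}

end CircleDecomp

/-!
A signal is constant on the circle, or supported at a single point of it, or the indicator of an
arc. Every arc arises in this way, and small perturbations of the centre and the radius merely move
its two endpoints. On the other hand, enlarging one radius slightly changes the number of
discontinuities if the disk meets the circle in a single point, or if its arc shares an endpoint
with another one. A robust decomposition in `f̄` therefore amounts to a matching of the up-jumps of
`f` with its down-jumps, each pair bounding an arc, together with a number of signals covering the
circle. Two matchings give sums that differ by a constant, so every matching occurs with at most one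
number of covering signals, and the condition `τ ≤ f̄_*` makes that number nonnegative. Finally,
going counterclockwise, each component of a proper superlevel set of `⟨f̄⟩` starts at an up-jump and
each up-jump starts exactly one of them, so that there are `f̄^* - f̄_* + τ` up-jumps.
-/

open Filter Topology
open Circle (angleDiff)
open scoped Real

namespace CircleDecomp

/-! ### Arcs of the circle -/

lemma mul_exp_angleDiff (a x : Circle) : a * Circle.exp (angleDiff a x) = x := by
  rw [mul_comm]; exact Circle.exp_angleDiff_mul

lemma angleDiff_mul_exp {a x : Circle} {t : ℝ} (h₀ : 0 ≤ angleDiff a x + t)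
    (h₁ : angleDiff a x + t < 2 * π) :
    angleDiff a (x * Circle.exp t) = angleDiff a x + t := by
  refine Circle.exp_injOn_Ico (a := 0) (b := 2 * π) (by simp)
    ⟨Circle.angleDiff_nonneg _ _, Circle.angleDiff_lt_two_pi _ _⟩ ⟨h₀, h₁⟩ ?_
  rw [← mul_right_inj a, mul_exp_angleDiff, Circle.exp_add, ← mul_assoc, mul_exp_angleDiff]

lemma angleDiff_inj {a x y : Circle} : angleDiff a x = angleDiff a y ↔ x = y := by
  refine ⟨fun h => ?_, fun h => h ▸ rfl⟩
  rw [← mul_exp_angleDiff a x, h, mul_exp_angleDiff]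

lemma angleDiff_self (a : Circle) : angleDiff a a = 0 := by
  refine Circle.exp_injOn_Ico (a := 0) (b := 2 * π) (by simp)
    ⟨Circle.angleDiff_nonneg _ _, Circle.angleDiff_lt_two_pi _ _⟩ (by simp [Real.pi_pos]) ?_
  rw [← mul_right_inj a, mul_exp_angleDiff, Circle.exp_zero, mul_one]

lemma angleDiff_self_mul_exp (a : Circle) {t : ℝ} (h₀ : 0 ≤ t) (h₁ : t < 2 * π) :
    angleDiff a (a * Circle.exp t) = t := by
  simpa only [angleDiff_self, zero_add] using
    angleDiff_mul_exp (a := a) (x := a) (t := t) (by simpa [angleDiff_self]) (by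
      simpa [angleDiff_self])

lemma mul_exp_ne_self (x : Circle) {t : ℝ} (h : t ≠ 0) (ht : |t| < 2 * π) :
    x * Circle.exp t ≠ x := by
  rw [abs_lt] at ht
  rw [Ne, mul_eq_left, ← Circle.exp_zero]
  rcases h.lt_or_gt with h | h
  · exact fun he => h.ne (Circle.exp_injOn_Ioc (a := -(2 * π)) (b := 0) (by simp)
      ⟨ht.1, h.le⟩ (by simp [Real.pi_pos]) he)
  · exact fun he => h.ne' (Circle.exp_injOn_Ico (a := 0) (b := 2 * π) (by simp)
      ⟨h.le, ht.2⟩ (by simp [Real.pi_pos]) he)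

lemma eventually_angleDiff_mul_exp_right (a x : Circle) :
    ∀ᶠ t in 𝓝[>] (0 : ℝ), angleDiff a (x * Circle.exp t) = angleDiff a x + t := by
  filter_upwards [Ioo_mem_nhdsGT (sub_pos.2 (Circle.angleDiff_lt_two_pi a x))] with t ht
  exact angleDiff_mul_exp (add_nonneg (Circle.angleDiff_nonneg _ _) ht.1.le) (by linarith [ht.2])

lemma eventually_angleDiff_mul_exp_left {a x : Circle} (h : x ≠ a) :
    ∀ᶠ t in 𝓝[<] (0 : ℝ), angleDiff a (x * Circle.exp t) = angleDiff a x + t := by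
  filter_upwards [Ioo_mem_nhdsLT (neg_lt_zero.2 (Circle.angleDiff_pos h.symm))] with t ht
  exact angleDiff_mul_exp (by linarith [ht.1])
    (by linarith [ht.2, Circle.angleDiff_lt_two_pi a x])

lemma eventually_angleDiff_self_mul_exp_left (a : Circle) :
    ∀ᶠ t in 𝓝[<] (0 : ℝ), angleDiff a (a * Circle.exp t) = 2 * π + t := by
  filter_upwards [Ioo_mem_nhdsLT (neg_lt_zero.2 Real.two_pi_pos)] with t ht
  rw [← Circle.exp_add_two_pi, add_comm t]
  exact angleDiff_self_mul_exp a (by linarith [ht.1]) (by linarith [ht.2])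

lemma nhds_eq_map_exp (x : Circle) : 𝓝 x = map (fun t : ℝ => x * Circle.exp t) (𝓝 0) := by
  have h_one : map Circle.exp (𝓝 0) = 𝓝 1 := by
    rw [isLocalHomeomorph_circleExp.map_nhds_eq, Circle.exp_zero]
  have h_mul : map (x * ·) (𝓝 (1 : Circle)) = 𝓝 x := by
    simpa only [Homeomorph.coe_mulLeft, mul_one] using (Homeomorph.mulLeft x).map_nhds_eq 1
  rw [← h_mul, ← h_one, map_map]; rfl

lemma eventually_nhds_circle {P : Circle → Prop} {x : Circle} :
    (∀ᶠ y in 𝓝 x, P y) ↔ P x ∧ (∀ᶠ t in 𝓝[<] (0 : ℝ), P (x * Circle.exp t)) ∧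
      ∀ᶠ t in 𝓝[>] (0 : ℝ), P (x * Circle.exp t) := by
  rw [nhds_eq_map_exp, eventually_map, ← nhdsNE_sup_pure, ← nhdsLT_sup_nhdsGT, eventually_sup,
    eventually_sup]
  simp [and_comm]

lemma continuousAt_angleDiff {a x : Circle} (h : x ≠ a) : ContinuousAt (angleDiff a) x := by
  have hev : ∀ᶠ t in 𝓝 (0 : ℝ), angleDiff a x + t = angleDiff a (x * Circle.exp t) := by
    have hpos := Circle.angleDiff_pos h.symm
    have hlt := Circle.angleDiff_lt_two_pi a x
    filter_upwards [Ioo_mem_nhds (neg_lt_zero.2 hpos) (sub_pos.2 hlt)] with t ht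
    exact (angleDiff_mul_exp (by linarith [ht.1]) (by linarith [ht.2])).symm
  rw [ContinuousAt, nhds_eq_map_exp, tendsto_map'_iff]
  refine Tendsto.congr' hev ?_
  simpa using (continuous_const.add continuous_id).tendsto (0 : ℝ) (f := fun t => angleDiff a x + t)

/-- The set of discontinuity points of a function on the circle. -/
def discSet (F : Circle → ℕ) : Set Circle := {x | ¬ ContinuousAt F x}

lemma continuousAt_iff_eventually_eq {X Y : Type*} [TopologicalSpace X] [TopologicalSpace Y]
    [DiscreteTopology Y] {F : X → Y} {x : X} : ContinuousAt F x ↔ ∀ᶠ y in 𝓝 x, F y = F x := by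
  rw [ContinuousAt, nhds_discrete Y, tendsto_pure]

/-- `F` has the value `l` on a short open arc ending at `x`, and the value `r` on a short open arc
starting at `x`, in counterclockwise direction: one-sided limits in the discrete space `ℕ`. -/
def HasSides (F : Circle → ℕ) (x : Circle) (l r : ℕ) : Prop :=
  (∀ᶠ t in 𝓝[<] (0 : ℝ), F (x * Circle.exp t) = l) ∧
    ∀ᶠ t in 𝓝[>] (0 : ℝ), F (x * Circle.exp t) = r

namespace HasSides

variable {F G : Circle → ℕ} {x : Circle} {l r l' r' : ℕ}

lemma limPlus_eq (h : HasSides F x l r) : limPlus F x = r :=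
  rightLim_eq_of_tendsto (tendsto_nhds_of_eventually_eq h.2)

lemma limMinus_eq (h : HasSides F x l r) : limMinus F x = l :=
  leftLim_eq_of_tendsto (tendsto_nhds_of_eventually_eq h.1)

lemma const (c : ℕ) (x : Circle) : HasSides (fun _ => c) x c c := by simp [HasSides]

lemma add (h : HasSides F x l r) (h' : HasSides G x l' r') :
    HasSides (fun y => F y + G y) x (l + l') (r + r') :=
  ⟨by filter_upwards [h.1, h'.1] with t ht ht' using congr_arg₂ _ ht ht',
    by filter_upwards [h.2, h'.2] with t ht ht' using congr_arg₂ _ ht ht'⟩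

lemma sum {ι : Type*} {s : Finset ι} {F : ι → Circle → ℕ} {l r : ι → ℕ}
    (h : ∀ i ∈ s, HasSides (F i) x (l i) (r i)) :
    HasSides (fun y => ∑ i ∈ s, F i y) x (∑ i ∈ s, l i) (∑ i ∈ s, r i) := by
  constructor
  · filter_upwards [(Finset.eventually_all s).2 fun i hi => (h i hi).1] with t ht
    exact Finset.sum_congr rfl ht
  · filter_upwards [(Finset.eventually_all s).2 fun i hi => (h i hi).2] with t ht
    exact Finset.sum_congr rfl ht

lemma continuousAt_iff (h : HasSides F x l r) : ContinuousAt F x ↔ l = F x ∧ r = F x := by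
  rw [continuousAt_iff_eventually_eq, eventually_nhds_circle]
  constructor
  · rintro ⟨-, hl, hr⟩
    obtain ⟨t, ht, htl⟩ := (hl.and h.1).exists
    obtain ⟨s, hs, hsr⟩ := (hr.and h.2).exists
    exact ⟨htl.symm.trans ht, hsr.symm.trans hs⟩
  · rintro ⟨rfl, hr⟩
    exact ⟨rfl, by rw [hr] at h; exact h⟩

lemma of_finite_ne (h : HasSides G x l r) (hfin : {y | G y ≠ F y}.Finite) : HasSides F x l r := by
  have h_agree : ∀ᶠ t in 𝓝[≠] (0 : ℝ), F (x * Circle.exp t) = G (x * Circle.exp t) := by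
    have h_nhds : ∀ᶠ y in 𝓝 x, y ∉ {y | G y ≠ F y} \ {x} :=
      (hfin.subset Set.sdiff_subset).isClosed.isOpen_compl.mem_nhds (by simp)
    rw [nhds_eq_map_exp, eventually_map] at h_nhds
    have h_small : ∀ᶠ t : ℝ in 𝓝 0, |t| < 2 * π :=
      continuous_abs.continuousAt.eventually_lt_const (by simp [Real.pi_pos])
    filter_upwards [nhdsWithin_le_nhds h_nhds, nhdsWithin_le_nhds h_small,
      self_mem_nhdsWithin] with t ht ht' ht0
    by_contra hne
    exact ht ⟨fun he => hne he.symm, mul_exp_ne_self x ht0 ht'⟩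
  rw [← nhdsLT_sup_nhdsGT, eventually_sup] at h_agree
  exact ⟨by filter_upwards [h.1, h_agree.1] with t ht ht' using ht'.trans ht,
    by filter_upwards [h.2, h_agree.2] with t ht ht' using ht'.trans ht⟩

end HasSides

/-- The indicator function of the closed arc that runs counterclockwise from `a` to `b`. -/
noncomputable def arc (a b x : Circle) : ℕ :=
  if angleDiff a x ≤ angleDiff a b then 1 else 0

lemma arc_le_one (a b x : Circle) : arc a b x ≤ 1 := by
  unfold arc; split_ifs <;> simp

lemma arc_left (a b : Circle) : arc a b a = 1 :=
  if_pos (by rw [angleDiff_self]; exact Circle.angleDiff_nonneg _ _)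

lemma arc_right (a b : Circle) : arc a b b = 1 := if_pos le_rfl

open scoped Classical in
lemma hasSides_arc {a b : Circle} (hab : a ≠ b) (x : Circle) :
    HasSides (arc a b) x (arc a b x - if x = a then 1 else 0)
      (arc a b x - if x = b then 1 else 0) := by
  constructor
  · rcases eq_or_ne x a with rfl | hxa
    · rw [arc_left, if_pos rfl]
      filter_upwards [eventually_angleDiff_self_mul_exp_left x,
        Ioo_mem_nhdsLT (sub_neg.2 (Circle.angleDiff_lt_two_pi x b))] with t ht ht'
      rw [arc, ht, if_neg (by linarith [ht'.1])]
    · rw [if_neg hxa, tsub_zero]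
      rcases le_or_gt (angleDiff a x) (angleDiff a b) with hxb | hxb
      · filter_upwards [eventually_angleDiff_mul_exp_left hxa, self_mem_nhdsWithin]
          with t ht (ht' : t < 0)
        rw [arc, arc, ht, if_pos (by linarith), if_pos hxb]
      · filter_upwards [eventually_angleDiff_mul_exp_left hxa,
          Ioo_mem_nhdsLT (sub_neg.2 hxb)] with t ht ht'
        rw [arc, arc, ht, if_neg (by linarith [ht'.1]), if_neg hxb.not_ge]
  · rcases eq_or_ne x b with rfl | hxb
    · rw [arc_right, if_pos rfl]
      filter_upwards [eventually_angleDiff_mul_exp_right a x, self_mem_nhdsWithin]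
        with t ht (ht' : 0 < t)
      rw [arc, ht, if_neg (by linarith)]
    · rw [if_neg hxb, tsub_zero]
      rcases lt_or_gt_of_ne (angleDiff_inj (a := a).not.2 hxb) with hxb | hxb
      · filter_upwards [eventually_angleDiff_mul_exp_right a x,
          Ioo_mem_nhdsGT (sub_pos.2 hxb)] with t ht ht'
        rw [arc, arc, ht, if_pos (by linarith [ht'.2]), if_pos hxb.le]
      · filter_upwards [eventually_angleDiff_mul_exp_right a x, self_mem_nhdsWithin]
          with t ht (ht' : 0 < t)
        rw [arc, arc, ht, if_neg (by linarith), if_neg hxb.not_ge]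

lemma discSet_arc {a b : Circle} (hab : a ≠ b) : discSet (arc a b) = {a, b} := by
  ext x
  rw [discSet, Set.mem_ofPred_eq, (hasSides_arc hab x).continuousAt_iff, Set.mem_insert_iff,
    Set.mem_singleton_iff]
  rcases eq_or_ne x a with rfl | hxa
  · simp [arc_left]
  · rcases eq_or_ne x b with rfl | hxb
    · simp [arc_right]
    · simp [hxa, hxb]

lemma arc_inj {a b a' b' : Circle} (hab : a ≠ b) (hab' : a' ≠ b') :
    arc a b = arc a' b' ↔ a = a' ∧ b = b' := by
  refine ⟨fun h => ?_, fun h => by rw [h.1, h.2]⟩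
  have h_left : limMinus (arc a b) a = limMinus (arc a' b') a := by rw [h]
  have h_right : limPlus (arc a b) b = limPlus (arc a' b') b := by rw [h]
  rw [(hasSides_arc hab _).limMinus_eq, (hasSides_arc hab' _).limMinus_eq, ← h, arc_left,
    if_pos rfl] at h_left
  rw [(hasSides_arc hab _).limPlus_eq, (hasSides_arc hab' _).limPlus_eq, ← h, arc_right,
    if_pos rfl] at h_right
  grind

/-! ### Cyclic sequences of values -/

/-- `l` is an increasing list of angles, all of them within one turn, that represents every
discontinuity point of `F` exactly once. -/
structure IsDiscLift (F : Circle → ℕ) (l : List ℝ) : Prop where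
  pairwise_lt : l.Pairwise (· < ·)
  lt_add_two_pi : ∀ s ∈ l, ∀ t ∈ l, t < s + 2 * π
  mem_discSet : ∀ x, x ∈ discSet F ↔ ∃ t ∈ l, Circle.exp t = x

namespace IsDiscLift

variable {F : Circle → ℕ} {l : List ℝ} {a : ℝ}

lemma injOn_exp (h : IsDiscLift F l) : Set.InjOn Circle.exp {t | t ∈ l} :=
  Circle.exp_injOn_of_forall_sub_mem_Ioo fun s hs t ht =>
    ⟨by linarith [h.lt_add_two_pi s hs t ht], by linarith [h.lt_add_two_pi t ht s hs]⟩

lemma ncard_discSet (h : IsDiscLift F l) : (discSet F).ncard = l.length := by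
  classical
  have h_image : discSet F = Circle.exp '' (l.toFinset : Set ℝ) := by
    ext x; simpa using h.mem_discSet x
  rw [h_image, Set.InjOn.ncard_image (by simpa using h.injOn_exp), Set.ncard_coe_finset,
    List.toFinset_card_of_nodup h.pairwise_lt.nodup]

lemma rotate_iff : IsDiscLift F (l ++ [a + 2 * π]) ↔ IsDiscLift F (a :: l) := by
  have h_mem (x : Circle) : (∃ t ∈ l ++ [a + 2 * π], Circle.exp t = x) ↔
      ∃ t ∈ a :: l, Circle.exp t = x := by
    simp only [List.mem_append, List.mem_cons, List.not_mem_nil, or_false, or_and_right, exists_or,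
      exists_eq_left, Circle.exp_add_two_pi]
    exact or_comm
  have h_turn : (∀ s ∈ l ++ [a + 2 * π], ∀ t ∈ l ++ [a + 2 * π], t < s + 2 * π) ↔
      (∀ s ∈ l, ∀ t ∈ l, t < s + 2 * π) ∧ (∀ s ∈ l, a < s) ∧ ∀ t ∈ l, t < a + 2 * π + 2 * π := by
    simp only [List.forall_mem_append, List.forall_mem_singleton, forall_and, add_lt_add_iff_right]
    simp [Real.pi_pos, and_assoc, and_comm]
  have h_turn' : (∀ s ∈ a :: l, ∀ t ∈ a :: l, t < s + 2 * π) ↔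
      (∀ s ∈ l, a < s + 2 * π) ∧ (∀ t ∈ l, t < a + 2 * π) ∧ ∀ s ∈ l, ∀ t ∈ l, t < s + 2 * π := by
    simp [forall_and, Real.pi_pos]
  have hpi := Real.two_pi_pos
  constructor <;> rintro ⟨hl, ht, hd⟩
  · obtain ⟨hl, -, hl'⟩ := List.pairwise_append.1 hl
    obtain ⟨ht, ha, -⟩ := h_turn.1 ht
    exact ⟨List.pairwise_cons.2 ⟨ha, hl⟩, h_turn'.2 ⟨fun s hs => by linarith [ha s hs],
      fun t ht => hl' t ht _ (by simp), ht⟩, by simpa only [h_mem] using hd⟩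
  · obtain ⟨ha, hl⟩ := List.pairwise_cons.1 hl
    obtain ⟨-, ha', ht⟩ := h_turn'.1 ht
    exact ⟨List.pairwise_append.2 ⟨hl, by simp, by simpa using ha'⟩,
      h_turn.2 ⟨ht, ha, fun t ht => by linarith [ha' t ht]⟩, by simpa only [h_mem] using hd⟩

/-- The midpoint of the arc between two consecutive lifts is a continuity point, as there are no
discontinuities inside the arc. -/
lemma continuousAt_midpoint (h : IsDiscLift F (a :: l)) {s t : ℝ}
    (hst : [s, t] <:+: a :: (l ++ [a + 2 * π])) :
    ContinuousAt F (Circle.exp ((s + t) / 2)) := by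
  have h_sorted : (a :: (l ++ [a + 2 * π])).Pairwise (· < ·) := by
    refine List.pairwise_cons.2 ⟨fun r hr => ?_, (rotate_iff.2 h).pairwise_lt⟩
    have := List.rel_of_pairwise_cons h.pairwise_lt (a' := r)
    grind [Real.pi_pos]
  have h_range : ∀ r ∈ a :: (l ++ [a + 2 * π]), a ≤ r ∧ r ≤ a + 2 * π := by
    rw [← List.cons_append] at h_sorted ⊢
    simp only [List.pairwise_append, List.cons_append, List.pairwise_cons, List.mem_append,
      List.mem_cons, List.not_mem_nil, or_false] at h_sorted ⊢
    grind [Real.pi_pos]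
  have hs := h_range s (hst.subset (by simp))
  have ht := h_range t (hst.subset (by simp))
  obtain ⟨u, w, huw⟩ := hst
  have h_gap : s < t ∧ ∀ r ∈ a :: (l ++ [a + 2 * π]), r ≤ s ∨ t ≤ r := by
    rw [← huw] at h_sorted ⊢
    simp only [List.pairwise_append, List.pairwise_cons, List.mem_append,
      List.mem_cons, List.not_mem_nil, or_false] at h_sorted ⊢
    grind
  by_contra hmid
  obtain ⟨r, hr, hre⟩ := (h.mem_discSet _).1 hmid
  have hra := h_range r (List.mem_append_left [a + 2 * π] hr)
  have h_eq : r = (s + t) / 2 :=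
    Circle.exp_injOn_Ico (a := a) (b := a + 2 * π) (by simp)
      ⟨hra.1, by linarith [h.lt_add_two_pi a (by simp) r hr]⟩
      ⟨by linarith [h_gap.1], by linarith [h_gap.1]⟩ hre
  rcases h_gap.2 r (List.mem_append_left [a + 2 * π] hr) with hrs | htr <;> linarith [h_gap.1]

end IsDiscLift

lemma exists_isDiscLift {F : Circle → ℕ} (hF : PiecewiseConst F) : ∃ l, IsDiscLift F l := by
  classical
  have h_range (t : ℝ) (ht : t ∈ (hF.toFinset.image (angleDiff 1)).sort) : 0 ≤ t ∧ t < 2 * π := by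
    obtain ⟨x, -, rfl⟩ := Finset.mem_image.1 ((Finset.mem_sort _).1 ht)
    exact ⟨Circle.angleDiff_nonneg 1 x, Circle.angleDiff_lt_two_pi 1 x⟩
  refine ⟨(hF.toFinset.image (angleDiff 1)).sort, (Finset.sortedLT_sort _).pairwise,
    fun s hs t ht => by linarith [(h_range s hs).1, (h_range t ht).2], fun x => ?_⟩
  have h_exp (y : Circle) : Circle.exp (angleDiff 1 y) = y := by simpa using mul_exp_angleDiff 1 y
  simpa [h_exp, discSet] using (Set.Finite.mem_toFinset hF).symm

lemma seqRep_eq_of_mem_Ico {F : Circle → ℕ} {l : List ℝ} (h : IsDiscLift F l)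
    (hl : ∀ t ∈ l, t ∈ Set.Ico 0 (2 * π)) : seqRep F = (arcValues F l : Cycle ℕ) := by
  classical
  have h_angles : discAngles F = ↑l.toFinset := by
    ext t
    rw [List.coe_toFinset]
    refine ⟨fun ⟨ht, hdisc⟩ => ?_, fun ht => ⟨hl t ht, (h.mem_discSet _).2 ⟨t, ht, rfl⟩⟩⟩
    obtain ⟨s, hs, hst⟩ := (h.mem_discSet _).1 hdisc
    rwa [← Circle.exp_injOn_Ico (a := 0) (b := 2 * π) (by simp) (hl s hs) ht hst]
  have hfin : (discAngles F).Finite := h_angles ▸ l.toFinset.finite_toSet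
  have h_toFinset : hfin.toFinset = l.toFinset :=
    Finset.coe_injective (by rw [hfin.coe_toFinset, h_angles])
  rw [seqRep, dif_pos hfin, h_toFinset]
  congr 2
  exact (List.toFinset_sort (· ≤ ·) h.pairwise_lt.nodup).2 (h.pairwise_lt.imp le_of_lt)

lemma arcValues_rotate (F : Circle → ℕ) (a : ℝ) (l : List ℝ) :
    arcValues F (l ++ [a + 2 * π]) ~r arcValues F (a :: l) := by
  have h_period (s t : ℝ) : F (Circle.exp ((s + 2 * π + (t + 2 * π)) / 2)) =
      F (Circle.exp ((s + t) / 2)) := by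
    rw [show (s + 2 * π + (t + 2 * π)) / 2 = (s + t) / 2 + 2 * π by ring, Circle.exp_add_two_pi]
  cases l with
  | nil => simp [arcValues, h_period, List.IsRotated.refl]
  | cons b l =>
    have h_append : l ++ (a + 2 * π) :: ([] ++ [b + 2 * π]) =
        (l ++ [a + 2 * π]) ++ [b + 2 * π] := by simp
    simp only [arcValues, List.cons_append, List.append_assoc, List.zipWith_cons_cons]
    rw [← List.cons_append, h_append, List.zipWith_append (by simp)]
    simp only [List.zipWith_cons_cons, List.zipWith_nil_left, h_period]
    exact (List.isRotated_append (l := [_])).symm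

lemma exists_eq_cons_of_lt {α : Type*} [Preorder α] {l : List α} (hl : l.Pairwise (· < ·)) {c : α}
    (h : ∃ t ∈ l, t < c) : ∃ a l', l = a :: l' ∧ a < c := by
  cases l with
  | nil => simp at h
  | cons a l =>
    obtain ⟨t, ht, htc⟩ := h
    rcases List.mem_cons.1 ht with rfl | ht
    · exact ⟨t, l, rfl, htc⟩
    · exact ⟨a, l, rfl, (List.rel_of_pairwise_cons hl ht).trans htc⟩

lemma exists_eq_concat_of_le {α : Type*} [Preorder α] {l : List α} (hl : l.Pairwise (· < ·))
    {c : α} (h : ∃ t ∈ l, c ≤ t) : ∃ l' b, l = l' ++ [b] ∧ c ≤ b := by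
  obtain rfl | ⟨l, b, rfl⟩ := List.eq_nil_or_concat' l
  · simp at h
  · obtain ⟨t, ht, htc⟩ := h
    rcases List.mem_append.1 ht with ht | ht
    · exact ⟨l, b, rfl, htc.trans ((List.pairwise_append.1 hl).2.2 t ht b (by simp)).le⟩
    · exact ⟨l, b, rfl, by rwa [← List.mem_singleton.1 ht]⟩

/-- Shifting an extreme lift by one turn rotates the list, and such shifts move any list of lifts
into `[0, 2π)`: they decrease its total distance from there, counted in turns. -/
lemma IsDiscLift.seqRep_eq {F : Circle → ℕ} {l : List ℝ} (h : IsDiscLift F l) :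
    seqRep F = (arcValues F l : Cycle ℕ) := by
  have h_floor (a : ℝ) : ⌊(a + 2 * π) / (2 * π)⌋ = ⌊a / (2 * π)⌋ + 1 := by
    rw [add_div, div_self Real.two_pi_pos.ne', Int.floor_add_one]
  induction hn : (l.map fun t => ⌊t / (2 * π)⌋.natAbs).sum using Nat.strong_induction_on
    generalizing l with | _ n ih
  subst hn
  by_cases h_neg : ∃ t ∈ l, t < 0
  · obtain ⟨a, l, rfl, ha⟩ := exists_eq_cons_of_lt h.pairwise_lt h_neg
    have := Int.floor_lt_zero.2 (div_neg_of_neg_of_pos ha Real.two_pi_pos)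
    rw [← Cycle.coe_eq_coe.2 (arcValues_rotate F a l)]
    refine ih _ ?_ (IsDiscLift.rotate_iff.2 h) rfl
    simp only [List.map_append, List.map_cons, List.sum_append, List.sum_cons, h_floor,
      List.map_nil, List.sum_nil]
    omega
  by_cases h_large : ∃ t ∈ l, 2 * π ≤ t
  · obtain ⟨l, b, rfl, hb⟩ := exists_eq_concat_of_le h.pairwise_lt h_large
    obtain ⟨a, rfl⟩ : ∃ a, b = a + 2 * π := ⟨b - 2 * π, by ring⟩
    have := Int.floor_nonneg.2 (div_nonneg (by linarith : 0 ≤ a) Real.two_pi_pos.le)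
    rw [Cycle.coe_eq_coe.2 (arcValues_rotate F a l)]
    refine ih _ ?_ (IsDiscLift.rotate_iff.1 h) rfl
    simp only [List.map_append, List.map_cons, List.sum_append, List.sum_cons, h_floor,
      List.map_nil, List.sum_nil]
    omega
  · push Not at h_neg h_large
    exact seqRep_eq_of_mem_Ico h fun t ht => ⟨h_neg t ht, h_large t ht⟩

lemma length_seqRep {F : Circle → ℕ} (hF : PiecewiseConst F) :
    (seqRep F).length = max 1 (discSet F).ncard := by
  obtain ⟨l, hl⟩ := exists_isDiscLift hF
  rw [hl.seqRep_eq, hl.ncard_discSet, Cycle.length_coe]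
  cases l <;> simp [arcValues]

lemma zipWith_eq_of_isChain {α β : Type*} {f g : α → α → β} {a c : α} {l : List α}
    (h : (a :: (l ++ [c])).IsChain fun s t => f s t = g s t) :
    List.zipWith f (a :: l) (l ++ [c]) = List.zipWith g (a :: l) (l ++ [c]) := by
  induction l generalizing a with
  | nil => simpa using h
  | cons b l ih =>
    rw [List.cons_append, List.isChain_cons_cons] at h
    simp only [List.cons_append, List.zipWith_cons_cons, h.1]
    exact congr_arg _ (ih h.2)

lemma arcValues_map {F G : Circle → ℕ} {A : ℝ → ℝ} {a : ℝ} {l : List ℝ}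
    (hA : A (a + 2 * π) = A a + 2 * π)
    (h : (a :: (l ++ [a + 2 * π])).IsChain fun s t =>
      G (Circle.exp ((A s + A t) / 2)) = F (Circle.exp ((s + t) / 2))) :
    arcValues G ((a :: l).map A) = arcValues F (a :: l) := by
  have h_end : l.map A ++ [A a + 2 * π] = (l ++ [a + 2 * π]).map A := by simp [hA]
  rw [arcValues, ← zipWith_eq_of_isChain h, List.map_cons, arcValues, h_end, ← List.map_cons,
    List.zipWith_map]

section Perturbation

variable {Y : Type*} [TopologicalSpace Y] {F : Y → Circle → ℕ} {y₀ : Y} {D : Circle → Y → ℝ}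
  {l : List ℝ}

lemma IsDiscLift.tendsto_perturb (hl : IsDiscLift (F y₀) l)
    (hD : ∀ x ∈ discSet (F y₀), Tendsto (D x) (𝓝 y₀) (𝓝 0)) {t : ℝ}
    (ht : Circle.exp t ∈ Circle.exp '' {t | t ∈ l}) :
    Tendsto (fun y => t + D (Circle.exp t) y) (𝓝 y₀) (𝓝 t) := by
  obtain ⟨s, hs, hst⟩ := ht
  simpa using (hD _ ((hl.mem_discSet _).2 ⟨s, hs, hst⟩)).const_add t

lemma IsDiscLift.eventually_map (hl : IsDiscLift (F y₀) l)
    (hD : ∀ x ∈ discSet (F y₀), Tendsto (D x) (𝓝 y₀) (𝓝 0))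
    (hdisc : ∀ᶠ y in 𝓝 y₀,
      discSet (F y) = (fun x => x * Circle.exp (D x y)) '' discSet (F y₀)) :
    ∀ᶠ y in 𝓝 y₀, IsDiscLift (F y) (l.map fun t => t + D (Circle.exp t) y) := by
  have h_tendsto (t) (ht : t ∈ l) := hl.tendsto_perturb hD (t := t) ⟨t, ht, rfl⟩
  have h_lt : ∀ᶠ y in 𝓝 y₀, ∀ s ∈ l, ∀ t ∈ l, s < t →
      s + D (Circle.exp s) y < t + D (Circle.exp t) y := by
    simp only [← List.mem_toFinset, Finset.eventually_all, eventually_imp_distrib_left]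
    simp only [List.mem_toFinset]
    exact fun s hs t ht hst => (h_tendsto s hs).eventually_lt (h_tendsto t ht) hst
  have h_turn : ∀ᶠ y in 𝓝 y₀, ∀ s ∈ l, ∀ t ∈ l,
      t + D (Circle.exp t) y < s + D (Circle.exp s) y + 2 * π := by
    simp only [← List.mem_toFinset, Finset.eventually_all]
    simp only [List.mem_toFinset]
    exact fun s hs t ht => (h_tendsto t ht).eventually_lt ((h_tendsto s hs).add_const _)
      (hl.lt_add_two_pi s hs t ht)
  filter_upwards [h_lt, h_turn, hdisc] with y h_lt h_turn hdisc
  refine ⟨List.pairwise_map.2 (hl.pairwise_lt.imp_of_mem fun hs ht => h_lt _ hs _ ht),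
    by simpa using h_turn, fun x => ?_⟩
  simp [hdisc, hl.mem_discSet, Circle.exp_add]

lemma eventually_seqRep_eq (h₀ : PiecewiseConst (F y₀))
    (hD : ∀ x ∈ discSet (F y₀), Tendsto (D x) (𝓝 y₀) (𝓝 0))
    (hdisc : ∀ᶠ y in 𝓝 y₀,
      discSet (F y) = (fun x => x * Circle.exp (D x y)) '' discSet (F y₀))
    (hF : ∀ x, ContinuousAt (F y₀) x → ∀ᶠ q in 𝓝 (y₀, x), F q.1 q.2 = F y₀ x) :
    ∀ᶠ y in 𝓝 y₀, seqRep (F y) = seqRep (F y₀) := by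
  obtain ⟨l, hl⟩ := exists_isDiscLift h₀
  suffices h_values : ∀ᶠ y in 𝓝 y₀,
      arcValues (F y) (l.map fun t => t + D (Circle.exp t) y) = arcValues (F y₀) l by
    filter_upwards [hl.eventually_map hD hdisc, h_values] with y hly h_values
    rw [hly.seqRep_eq, h_values, hl.seqRep_eq]
  have h_along {γ : Y → Circle} {x : Circle} (hγ : Tendsto γ (𝓝 y₀) (𝓝 x))
      (hx : ContinuousAt (F y₀) x) : ∀ᶠ y in 𝓝 y₀, F y (γ y) = F y₀ x :=
    (tendsto_id.prodMk_nhds hγ).eventually (hF x hx)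
  cases l with
  | nil =>
    have h_one : ContinuousAt (F y₀) 1 := by
      by_contra h
      simpa using (hl.mem_discSet 1).1 h
    filter_upwards [h_along tendsto_const_nhds h_one] with y hy
    simp [arcValues, hy]
  | cons a l =>
    have h_tendsto (t) (ht : t ∈ a :: (l ++ [a + 2 * π])) := hl.tendsto_perturb hD (t := t) <| by
      rcases List.mem_append.1 (List.cons_append ▸ ht) with ht | ht
      · exact ⟨t, ht, rfl⟩
      · exact ⟨a, by simp, by rw [List.mem_singleton.1 ht, Circle.exp_add_two_pi]⟩
    have h_mid : ∀ᶠ y in 𝓝 y₀, ∀ s ∈ a :: (l ++ [a + 2 * π]), ∀ t ∈ a :: (l ++ [a + 2 * π]),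
        [s, t] <:+: a :: (l ++ [a + 2 * π]) →
        F y (Circle.exp ((s + D (Circle.exp s) y + (t + D (Circle.exp t) y)) / 2)) =
          F y₀ (Circle.exp ((s + t) / 2)) := by
      simp only [← List.mem_toFinset, Finset.eventually_all, eventually_imp_distrib_left]
      simp only [List.mem_toFinset]
      intro s hs t ht hst
      have h_angle := ((h_tendsto s hs).add (h_tendsto t ht)).div_const 2
      exact h_along ((Circle.exp.continuous.tendsto _).comp h_angle) (hl.continuousAt_midpoint hst)
    filter_upwards [h_mid] with y hy
    refine arcValues_map (by rw [Circle.exp_add_two_pi]; ring) ?_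
    exact (List.isChain_isInfix _).imp fun s t hst =>
      hy s (hst.subset (by simp)) t (hst.subset (by simp)) hst

end Perturbation

/-! ### Signals that cut out an arc -/

lemma norm_exp_sub_sq (t ρ θ : ℝ) :
    ‖((Circle.exp t : Circle) : ℂ) - ρ * (Circle.exp θ : Circle)‖ ^ 2 =
      1 + ρ ^ 2 - 2 * ρ * Real.cos (t - θ) := by
  rw [← Complex.normSq_eq_norm_sq, Complex.normSq_apply, Circle.coe_exp, Circle.coe_exp]
  simp only [Complex.sub_re, Complex.sub_im, Complex.re_ofReal_mul, Complex.im_ofReal_mul,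
    Complex.exp_ofReal_mul_I_re, Complex.exp_ofReal_mul_I_im, Real.cos_sub]
  linear_combination Real.sin_sq_add_cos_sq t + ρ ^ 2 * Real.sin_sq_add_cos_sq θ

lemma cos_le_cos_sub_iff {s w : ℝ} (hs : 0 ≤ s) (hs' : s < 2 * π) (hw : 0 < w) (hw' : w < π) :
    Real.cos w ≤ Real.cos (s - w) ↔ s ≤ 2 * w := by
  rcases le_or_gt (s - w) π with h | h
  · rw [← Real.cos_abs (s - w), Real.strictAntiOn_cos.le_iff_ge
      ⟨hw.le, hw'.le⟩ ⟨abs_nonneg _, abs_le.2 ⟨by linarith, h⟩⟩, abs_le]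
    constructor
    · intro h; linarith [h.2]
    · intro h; constructor <;> linarith
  · rw [← Real.cos_two_pi_sub (s - w),
      Real.strictAntiOn_cos.le_iff_ge ⟨hw.le, hw'.le⟩ ⟨by linarith, by linarith⟩]
    constructor <;> intro h <;> linarith

section Polar

variable {ρ θ w r : ℝ}

lemma exp_sub_mul_exp_two_mul (θ w : ℝ) :
    Circle.exp (θ - w) * Circle.exp (2 * w) = Circle.exp (θ + w) := by
  rw [← Circle.exp_add]; congr 1; ring

lemma exp_sub_ne_exp_add (θ : ℝ) (hw : 0 < w) (hw' : w < π) :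
    Circle.exp (θ - w) ≠ Circle.exp (θ + w) := by
  rw [← exp_sub_mul_exp_two_mul]
  exact (mul_exp_ne_self _ (by linarith) (by rw [abs_of_pos] <;> linarith)).symm

lemma circleSignal_polar (hρ : 0 < ρ) (hr : 0 ≤ r) (hw : 0 < w) (hw' : w < π)
    (h : 1 + ρ ^ 2 - r ^ 2 = 2 * ρ * Real.cos w) :
    circleSignal (ρ * (Circle.exp θ : Circle), r) =
      arc (Circle.exp (θ - w)) (Circle.exp (θ + w)) := by
  funext x
  set s := angleDiff (Circle.exp (θ - w)) x with hs
  have hx : x = Circle.exp (θ - w + s) := by rw [Circle.exp_add, hs, mul_exp_angleDiff]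
  have h_width : angleDiff (Circle.exp (θ - w)) (Circle.exp (θ + w)) = 2 * w := by
    rw [← exp_sub_mul_exp_two_mul, angleDiff_self_mul_exp _ (by linarith) (by linarith)]
  rw [arc, h_width, ← hs, circleSignal, signal, hx]
  refine if_congr ?_ rfl rfl
  rw [← cos_le_cos_sub_iff (Circle.angleDiff_nonneg _ _) (Circle.angleDiff_lt_two_pi _ _) hw hw',
    ← sq_le_sq₀ (norm_nonneg _) hr, norm_exp_sub_sq, show θ - w + s - θ = s - w by ring,
    ← mul_le_mul_iff_right₀ (b := Real.cos w) (show 0 < 2 * ρ by linarith)]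
  constructor <;> intro h <;> linarith

lemma eq_of_norm_sub_eq (hρ : 0 < ρ) (h : 1 + ρ ^ 2 - r ^ 2 = 2 * ρ * Real.cos w) {x : Circle}
    (hx : ‖(x : ℂ) - ρ * (Circle.exp θ : Circle)‖ = r) :
    x = Circle.exp (θ - w) ∨ x = Circle.exp (θ + w) := by
  obtain ⟨t, rfl⟩ := Circle.exp_surjective x
  have h_cos : Real.cos w = Real.cos (t - θ) := by
    rw [← hx, norm_exp_sub_sq] at h
    exact mul_left_cancel₀ (show 2 * ρ ≠ 0 by positivity) (by linarith)
  obtain ⟨k, hk | hk⟩ := Real.cos_eq_cos_iff.1 h_cos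
  · right; rw [Circle.exp_eq_exp]; exact ⟨k, by linarith⟩
  · left; rw [Circle.exp_eq_exp]; exact ⟨k, by linarith⟩

end Polar

lemma eq_norm_mul_exp_arg (z : ℂ) : z = ‖z‖ * (Circle.exp z.arg : Circle) := by
  rw [Circle.coe_exp, Complex.norm_mul_exp_arg_mul_I]

/-- The boundary of the disk crosses the unit circle at two points, i.e. the restriction of the
signal to the circle is the indicator function of a proper arc. -/
def Proper (p : ℂ × ℝ) : Prop := |1 - ‖p.1‖| < p.2 ∧ p.2 < 1 + ‖p.1‖

/-- Half of the angle that the arc of a proper signal spans, by the law of cosines. -/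
noncomputable def halfWidth (p : ℂ × ℝ) : ℝ :=
  Real.arccos ((1 + ‖p.1‖ ^ 2 - p.2 ^ 2) / (2 * ‖p.1‖))

namespace Proper

variable {p : ℂ × ℝ}

lemma norm_pos (h : Proper p) : 0 < ‖p.1‖ := by
  rcases (norm_nonneg p.1).eq_or_lt with h0 | h0
  · have := h.1.trans h.2; rw [← h0] at this; norm_num at this
  · exact h0

lemma radius_pos (h : Proper p) : 0 < p.2 := (abs_nonneg _).trans_lt h.1

lemma halfWidth_spec (h : Proper p) : 0 < halfWidth p ∧ halfWidth p < π ∧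
    1 + ‖p.1‖ ^ 2 - p.2 ^ 2 = 2 * ‖p.1‖ * Real.cos (halfWidth p) := by
  have h_norm := h.norm_pos
  have h_sq : (1 - ‖p.1‖) ^ 2 < p.2 ^ 2 := by
    rw [← sq_abs]; exact pow_lt_pow_left₀ h.1 (abs_nonneg _) two_ne_zero
  have h_sq' : p.2 ^ 2 < (1 + ‖p.1‖) ^ 2 := pow_lt_pow_left₀ h.2 h.radius_pos.le two_ne_zero
  have h_lt : (1 + ‖p.1‖ ^ 2 - p.2 ^ 2) / (2 * ‖p.1‖) < 1 := by
    rw [div_lt_one (by linarith)]; nlinarith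
  have h_gt : -1 < (1 + ‖p.1‖ ^ 2 - p.2 ^ 2) / (2 * ‖p.1‖) := by
    rw [lt_div_iff₀ (by linarith)]; nlinarith
  refine ⟨Real.arccos_pos.2 h_lt, ?_, ?_⟩
  · rw [← Real.arccos_neg_one]
    exact Real.strictAntiOn_arccos ⟨le_rfl, by norm_num⟩ ⟨h_gt.le, h_lt.le⟩ h_gt
  · rw [halfWidth, Real.cos_arccos h_gt.le h_lt.le]; field_simp

lemma circleSignal_eq (h : Proper p) {θ : ℝ} (hθ : p.1 = ‖p.1‖ * (Circle.exp θ : Circle)) :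
    circleSignal p = arc (Circle.exp (θ - halfWidth p)) (Circle.exp (θ + halfWidth p)) := by
  obtain ⟨hw, hw', h_cos⟩ := h.halfWidth_spec
  rw [← circleSignal_polar h.norm_pos h.radius_pos.le hw hw' h_cos, ← hθ]

lemma discSet_eq (h : Proper p) {θ : ℝ} (hθ : p.1 = ‖p.1‖ * (Circle.exp θ : Circle)) :
    discSet (circleSignal p) =
      {Circle.exp (θ - halfWidth p), Circle.exp (θ + halfWidth p)} := by
  rw [h.circleSignal_eq hθ,
    discSet_arc (exp_sub_ne_exp_add θ h.halfWidth_spec.1 h.halfWidth_spec.2.1)]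

lemma exists_arc (h : Proper p) : ∃ a b, a ≠ b ∧ circleSignal p = arc a b :=
  ⟨_, _, exp_sub_ne_exp_add _ h.halfWidth_spec.1 h.halfWidth_spec.2.1,
    h.circleSignal_eq (eq_norm_mul_exp_arg p.1)⟩

lemma ncard_discSet (h : Proper p) : (discSet (circleSignal p)).ncard = 2 := by
  obtain ⟨a, b, hab, hp⟩ := h.exists_arc
  rw [hp, discSet_arc hab, Set.ncard_pair hab]

lemma mem_discSet_of_norm_eq (h : Proper p) {x : Circle} (hx : ‖(x : ℂ) - p.1‖ = p.2) :
    x ∈ discSet (circleSignal p) := by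
  rw [h.discSet_eq (eq_norm_mul_exp_arg p.1)]
  rw [eq_norm_mul_exp_arg p.1] at hx
  exact eq_of_norm_sub_eq h.norm_pos h.halfWidth_spec.2.2 hx

protected lemma eventually (h : Proper p) : ∀ᶠ q in 𝓝 p, Proper q :=
  (ContinuousAt.eventually_lt (by fun_prop) (by fun_prop) h.1).and
    (ContinuousAt.eventually_lt (by fun_prop) (by fun_prop) h.2)

lemma continuousAt_halfWidth (h : Proper p) : ContinuousAt halfWidth p := by
  have h_ne : 2 * ‖p.1‖ ≠ 0 := by have := h.norm_pos; positivity
  exact Real.continuous_arccos.continuousAt.comp (ContinuousAt.div (by fun_prop) (by fun_prop) h_ne)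

end Proper

lemma exists_proper_of_ne {a b : Circle} (hab : a ≠ b) :
    ∃ p, Proper p ∧ circleSignal p = arc a b := by
  obtain ⟨w, hw⟩ : ∃ w, angleDiff a b = 2 * w := ⟨angleDiff a b / 2, by ring⟩
  have hw₀ : 0 < w := by linarith [Circle.angleDiff_pos hab]
  have hw₁ : w < π := by linarith [Circle.angleDiff_lt_two_pi a b]
  obtain ⟨t, rfl⟩ := Circle.exp_surjective a
  have h_sin_pos : 0 < Real.sin (w / 2) :=
    Real.sin_pos_of_pos_of_lt_pi (by linarith) (by linarith)
  have h_sin_lt : Real.sin (w / 2) < 1 := by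
    rw [← Real.sin_pi_div_two]
    exact Real.strictMonoOn_sin ⟨by linarith, by linarith⟩ ⟨by linarith, le_rfl⟩ (by linarith)
  -- centre on the unit circle, radius equal to the chord spanned by half of the arc
  refine ⟨((1 : ℝ) * (Circle.exp (t + w) : Circle), 2 * Real.sin (w / 2)), ⟨?_, ?_⟩, ?_⟩
  · simpa using h_sin_pos
  · simp; linarith
  · rw [circleSignal_polar one_pos (by positivity) hw₀ hw₁]
    · rw [add_sub_cancel_right, add_assoc, ← two_mul, ← hw, Circle.exp_add, mul_exp_angleDiff]
    · have h_double : Real.cos w = 1 - 2 * Real.sin (w / 2) ^ 2 := by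
        rw [← Real.cos_two_mul_eq_one_sub, mul_div_cancel₀ _ two_ne_zero]
      rw [h_double]; ring

/-! ### Robustness -/

lemma circleSignal_eq_one {p : ℂ × ℝ} (h : 1 + ‖p.1‖ ≤ p.2) : circleSignal p = 1 := by
  funext x
  refine if_pos ?_
  calc ‖(x : ℂ) - p.1‖ ≤ ‖(x : ℂ)‖ + ‖p.1‖ := norm_sub_le _ _
    _ ≤ p.2 := by rwa [Circle.norm_coe]

lemma circleSignal_eq_zero {p : ℂ × ℝ} (h : p.2 < |1 - ‖p.1‖|) : circleSignal p = 0 := by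
  funext x
  have h_dist := abs_norm_sub_norm_le (x : ℂ) p.1
  rw [Circle.norm_coe] at h_dist
  exact if_neg (h.trans_le h_dist).not_ge

lemma discSet_circleSignal_eq_empty {p : ℂ × ℝ} (h : 1 + ‖p.1‖ ≤ p.2 ∨ p.2 < |1 - ‖p.1‖|) :
    discSet (circleSignal p) = ∅ := by
  refine Set.eq_empty_iff_forall_notMem.2 fun x => not_not.2 ?_
  rcases h with h | h
  · rw [circleSignal_eq_one h]; exact continuousAt_const
  · rw [circleSignal_eq_zero h]; exact continuousAt_const

lemma eventually_circleSignal_eq {p : ℂ × ℝ} {x : Circle} (h : ‖(x : ℂ) - p.1‖ ≠ p.2) :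
    ∀ᶠ q in 𝓝 (p, x), circleSignal q.1 q.2 = circleSignal p x := by
  rcases h.lt_or_gt with h | h
  · filter_upwards [ContinuousAt.eventually_lt (x₀ := (p, x))
      (f := fun q : (ℂ × ℝ) × Circle => ‖(q.2 : ℂ) - q.1.1‖) (g := fun q => q.1.2)
      (by fun_prop) (by fun_prop) h] with q hq
    rw [circleSignal, circleSignal, signal, signal, if_pos hq.le, if_pos h.le]
  · filter_upwards [ContinuousAt.eventually_lt (x₀ := (p, x))
      (f := fun q : (ℂ × ℝ) × Circle => q.1.2) (g := fun q => ‖(q.2 : ℂ) - q.1.1‖)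
      (by fun_prop) (by fun_prop) h] with q hq
    rw [circleSignal, circleSignal, signal, signal, if_neg hq.not_ge, if_neg h.not_ge]

lemma norm_eq_of_mem_discSet {p : ℂ × ℝ} {x : Circle} (h : x ∈ discSet (circleSignal p)) :
    ‖(x : ℂ) - p.1‖ = p.2 := by
  by_contra hne
  refine h (continuousAt_iff_eventually_eq.2 ?_)
  exact (Continuous.prodMk_right p).continuousAt.eventually (eventually_circleSignal_eq hne)

lemma eventually_circleSignal_le (p : ℂ × ℝ) (x : Circle) :
    ∀ᶠ y in 𝓝 x, circleSignal p y ≤ circleSignal p x := by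
  by_cases h : ‖(x : ℂ) - p.1‖ ≤ p.2
  · refine Eventually.of_forall fun y => ?_
    rw [circleSignal, circleSignal, signal, signal, if_pos h]
    split_ifs <;> simp
  · have hx : ContinuousAt (circleSignal p) x :=
      not_not.1 fun hx => h (norm_eq_of_mem_discSet hx).le
    exact (continuousAt_iff_eventually_eq.1 hx).mono fun y hy => hy.le

-- Signals are upper semicontinuous, so discontinuities cannot cancel in a sum of signals.
lemma discSet_totalSignal {n : ℕ} (v : Fin n → ℂ × ℝ) :
    discSet (totalSignal v) = ⋃ i, discSet (circleSignal (v i)) := by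
  ext x
  rw [Set.mem_iUnion, ← not_iff_not, not_exists]
  simp only [discSet, Set.mem_ofPred_eq, not_not, continuousAt_iff_eventually_eq]
  refine ⟨fun h i => ?_, fun h => ?_⟩
  · filter_upwards [h, eventually_all.2 fun j => eventually_circleSignal_le (v j) x] with y hy hle
    exact (Finset.sum_eq_sum_iff_of_le fun j _ => hle j).1 hy i (Finset.mem_univ i)
  · filter_upwards [eventually_all.2 h] with y hy
    exact Finset.sum_congr rfl fun j _ => hy j

lemma subsingleton_discSet_of_tangent {p : ℂ × ℝ} (h : p.2 = |1 - ‖p.1‖|) (h' : p.2 < 1 + ‖p.1‖) :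
    (discSet (circleSignal p)).Subsingleton := by
  have h_norm : 0 < ‖p.1‖ := by
    rcases (norm_nonneg p.1).eq_or_lt with h0 | h0
    · rw [h, ← h0] at h'; norm_num at h'
    · exact h0
  have h_eq : ∀ x ∈ discSet (circleSignal p), x = Circle.exp p.1.arg := by
    intro x hx
    have hx := norm_eq_of_mem_discSet hx
    rw [eq_norm_mul_exp_arg p.1] at hx
    simpa using eq_of_norm_sub_eq (w := 0) h_norm (by rw [h, sq_abs]; simp; ring) hx
  exact fun x hx y hy => (h_eq x hx).trans (h_eq y hy).symm

lemma finite_discSet_circleSignal (p : ℂ × ℝ) : (discSet (circleSignal p)).Finite := by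
  rcases le_or_gt (1 + ‖p.1‖) p.2 with h | h
  · simp [discSet_circleSignal_eq_empty (Or.inl h)]
  · rcases lt_trichotomy p.2 |1 - ‖p.1‖| with h' | h' | h'
    · simp [discSet_circleSignal_eq_empty (Or.inr h')]
    · exact (subsingleton_discSet_of_tangent h' h).finite
    · exact Set.finite_of_ncard_ne_zero (by simp [Proper.ncard_discSet ⟨h', h⟩])

lemma piecewiseConst_totalSignal {n : ℕ} (v : Fin n → ℂ × ℝ) : PiecewiseConst (totalSignal v) := by
  change (discSet (totalSignal v)).Finite
  rw [discSet_totalSignal]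
  exact Set.finite_iUnion fun i => finite_discSet_circleSignal _

/-- The two circles cross at two points, or the disk contains the unit circle in its interior:
the data for which a small perturbation moves the discontinuities of the signal continuously and
creates no new ones. -/
def Stable (p : ℂ × ℝ) : Prop := Proper p ∨ 1 + ‖p.1‖ < p.2

lemma Stable.norm_ne {p : ℂ × ℝ} (h : Stable p) {x : Circle} (hx : x ∉ discSet (circleSignal p)) :
    ‖(x : ℂ) - p.1‖ ≠ p.2 := by
  rcases h with h | h
  · exact fun he => hx (h.mem_discSet_of_norm_eq he)
  · refine ((norm_sub_le (x : ℂ) p.1).trans_lt ?_).ne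
    rwa [Circle.norm_coe]

-- The angle is measured from the direction of `z₀`, which keeps it away from the cut of `arg`.
lemma exists_continuousAt_angle {z₀ : ℂ} (hz₀ : z₀ ≠ 0) :
    ∃ θ : ℂ → ℝ, ContinuousAt θ z₀ ∧ ∀ z, z = ‖z‖ * (Circle.exp (θ z) : Circle) := by
  refine ⟨fun z => z₀.arg + (z / z₀).arg, continuousAt_const.add ?_, fun z => ?_⟩
  · exact ContinuousAt.comp (g := Complex.arg) (Complex.continuousAt_arg (by simp [hz₀]))
      (by fun_prop)
  · have h_norm : (‖z₀‖ : ℂ) ≠ 0 := by simpa using hz₀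
    have h_quot : z / z₀ = ‖z‖ / ‖z₀‖ * (Circle.exp (z / z₀).arg : Circle) := by
      simpa using eq_norm_mul_exp_arg (z / z₀)
    calc z = z₀ * (z / z₀) := by field_simp
      _ = ‖z₀‖ * (Circle.exp z₀.arg : Circle) *
          (‖z‖ / ‖z₀‖ * (Circle.exp (z / z₀).arg : Circle)) := by
        rw [← eq_norm_mul_exp_arg, ← h_quot]
      _ = ‖z‖ * (Circle.exp (z₀.arg + (z / z₀).arg) : Circle) := by
        rw [Circle.exp_add, Circle.coe_mul]; field_simp

lemma Stable.exists_displacement {p₀ : ℂ × ℝ} (h : Stable p₀) : ∃ D : Circle → ℂ × ℝ → ℝ,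
    (∀ x ∈ discSet (circleSignal p₀), Tendsto (D x) (𝓝 p₀) (𝓝 0)) ∧
      ∀ᶠ p in 𝓝 p₀, discSet (circleSignal p) =
        (fun x => x * Circle.exp (D x p)) '' discSet (circleSignal p₀) := by
  classical
  rcases h with h | h
  · obtain ⟨θ, hθ, h_polar⟩ := exists_continuousAt_angle (norm_pos_iff.1 h.norm_pos)
    have hθ' : ContinuousAt (fun p : ℂ × ℝ => θ p.1) p₀ := hθ.comp continuousAt_fst
    set α : ℂ × ℝ → ℝ := fun p => θ p.1 - halfWidth p
    set β : ℂ × ℝ → ℝ := fun p => θ p.1 + halfWidth p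
    have h_disc (p) (hp : Proper p) :
        discSet (circleSignal p) = {Circle.exp (α p), Circle.exp (β p)} :=
      hp.discSet_eq (h_polar p.1)
    have h_ne : Circle.exp (α p₀) ≠ Circle.exp (β p₀) :=
      exp_sub_ne_exp_add _ h.halfWidth_spec.1 h.halfWidth_spec.2.1
    have hα : Tendsto (fun p => α p - α p₀) (𝓝 p₀) (𝓝 0) :=
      tendsto_sub_nhds_zero_iff.2 (hθ'.sub h.continuousAt_halfWidth)
    have hβ : Tendsto (fun p => β p - β p₀) (𝓝 p₀) (𝓝 0) :=
      tendsto_sub_nhds_zero_iff.2 (hθ'.add h.continuousAt_halfWidth)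
    refine ⟨fun x p => if x = Circle.exp (α p₀) then α p - α p₀ else β p - β p₀,
      fun x _ => by beta_reduce; split_ifs <;> assumption, ?_⟩
    filter_upwards [h.eventually] with p hp
    rw [h_disc p₀ h, h_disc p hp, Set.image_pair, if_pos rfl, if_neg h_ne.symm, ← Circle.exp_add,
      ← Circle.exp_add, add_sub_cancel, add_sub_cancel]
  · refine ⟨fun _ _ => 0, fun x _ => tendsto_const_nhds, ?_⟩
    filter_upwards [ContinuousAt.eventually_lt (f := fun p : ℂ × ℝ => 1 + ‖p.1‖) (g := Prod.snd)
      (by fun_prop) (by fun_prop) h] with p hp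
    rw [discSet_circleSignal_eq_empty (Or.inl h.le), discSet_circleSignal_eq_empty (Or.inl hp.le),
      Set.image_empty]

section Robust

variable {n : ℕ} {v : Fin n → ℂ × ℝ}

lemma eventually_totalSignal_eq (hv : ∀ i, Stable (v i)) {x : Circle}
    (hx : ContinuousAt (totalSignal v) x) :
    ∀ᶠ q in 𝓝 (v, x), totalSignal q.1 q.2 = totalSignal v x := by
  have hx (i) : x ∉ discSet (circleSignal (v i)) := fun hi =>
    ((discSet_totalSignal v).symm.subset (Set.mem_iUnion_of_mem i hi)) hx
  have h_each (i) : ∀ᶠ q in 𝓝 (v, x), circleSignal (q.1 i) q.2 = circleSignal (v i) x := by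
    have h_cont : Continuous fun q : (Fin n → ℂ × ℝ) × Circle => (q.1 i, q.2) := by fun_prop
    exact (h_cont.tendsto (v, x)).eventually (eventually_circleSignal_eq ((hv i).norm_ne (hx i)))
  filter_upwards [eventually_all.2 h_each] with q hq
  exact Finset.sum_congr rfl fun i _ => hq i

lemma eventually_seqRep_totalSignal_eq (hv : ∀ i, Stable (v i))
    (h_disj : Pairwise fun i j =>
      Disjoint (discSet (circleSignal (v i))) (discSet (circleSignal (v j)))) :
    ∀ᶠ w in 𝓝 v, seqRep (totalSignal w) = seqRep (totalSignal v) := by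
  choose D hD hD_disc using fun i => (hv i).exists_displacement
  obtain ⟨E, hE⟩ : ∃ E : Circle → (Fin n → ℂ × ℝ) → ℝ, ∀ i, ∀ x ∈ discSet (circleSignal (v i)),
      ∀ w, E x w = D i x (w i) := by
    classical
    refine ⟨fun x w => if h : ∃ i, x ∈ discSet (circleSignal (v i)) then
      D h.choose x (w h.choose) else 0, fun i x hx w => ?_⟩
    have h : ∃ i, x ∈ discSet (circleSignal (v i)) := ⟨i, hx⟩
    have h_choose : h.choose = i := h_disj.eq (Set.not_disjoint_iff.2 ⟨x, h.choose_spec, hx⟩)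
    simp only [dif_pos h, h_choose]
  have h_proj (i : Fin n) : Tendsto (fun w : Fin n → ℂ × ℝ => w i) (𝓝 v) (𝓝 (v i)) :=
    (continuous_apply i).tendsto v
  refine eventually_seqRep_eq (D := E) (piecewiseConst_totalSignal v) (fun x hx => ?_) ?_
    fun x hx => eventually_totalSignal_eq hv hx
  · rw [discSet_totalSignal, Set.mem_iUnion] at hx
    obtain ⟨i, hi⟩ := hx
    exact ((hD i x hi).comp (h_proj i)).congr fun w => (hE i x hi w).symm
  · filter_upwards [eventually_all.2 fun i => (h_proj i).eventually (hD_disc i)] with w hw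
    rw [discSet_totalSignal, discSet_totalSignal, Set.image_iUnion]
    refine Set.iUnion_congr fun i => (hw i).trans (Set.image_congr fun x hx => ?_)
    rw [hE i x hx]

lemma norm_le_one_of_sqrt_sum_sq_eq_one {u : Fin n → ℂ × ℝ}
    (hu : √(∑ i, (‖(u i).1‖ ^ 2 + (u i).2 ^ 2)) = 1) : ‖u‖ ≤ 1 := by
  rw [Real.sqrt_eq_one] at hu
  refine (pi_norm_le_iff_of_nonneg zero_le_one).2 fun i => ?_
  have h_term : ‖(u i).1‖ ^ 2 + (u i).2 ^ 2 ≤ 1 := by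
    rw [← hu]
    exact Finset.single_le_sum (f := fun i => ‖(u i).1‖ ^ 2 + (u i).2 ^ 2)
      (fun j _ => by positivity) (Finset.mem_univ i)
  rw [Prod.norm_def, max_le_iff, Real.norm_eq_abs, ← sq_le_one_iff₀ (norm_nonneg _),
    ← sq_le_one_iff_abs_le_one]
  constructor <;> nlinarith

lemma robust_of_stable (hv : ∀ i, Stable (v i))
    (h_disj : Pairwise fun i j =>
      Disjoint (discSet (circleSignal (v i))) (discSet (circleSignal (v j)))) : Robust v := by
  obtain ⟨δ, hδ, h_ball⟩ :=
    Metric.eventually_nhds_iff.1 (eventually_seqRep_totalSignal_eq hv h_disj)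
  refine ⟨δ, hδ, fun ε hε u hu => h_ball ?_⟩
  rw [dist_eq_norm, add_sub_cancel_left, norm_smul, Real.norm_eq_abs, abs_of_pos hε.1]
  calc ε * ‖u‖ ≤ ε * 1 := by gcongr; exacts [hε.1.le, norm_le_one_of_sqrt_sum_sq_eq_one hu]
    _ < δ := by rw [mul_one]; exact hε.2

end Robust

namespace Robust

variable {n : ℕ} {v : Fin n → ℂ × ℝ}

lemma eventually_seqRep_update (hv : Robust v) (i : Fin n) :
    ∀ᶠ r in 𝓝[>] (v i).2,
      seqRep (totalSignal (Function.update v i ((v i).1, r))) = seqRep (totalSignal v) := by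
  obtain ⟨δ, hδ, h_robust⟩ := hv
  filter_upwards [Ioo_mem_nhdsGT (lt_add_of_pos_right (v i).2 hδ)] with r hr
  rw [← h_robust (r - (v i).2) ⟨by linarith [hr.1], by linarith [hr.2]⟩ (Pi.single i (0, 1))]
  · congr 2
    ext j : 1
    rcases eq_or_ne j i with rfl | hj
    · ext <;> simp
    · simp [hj]
  · rw [Finset.sum_eq_single i (fun j _ hj => by simp [hj]) (by simp)]
    simp

lemma two_le_ncard_sdiff (hv : Robust v) (i : Fin n) (h : |1 - ‖(v i).1‖| ≤ (v i).2)
    (h' : (v i).2 < 1 + ‖(v i).1‖) :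
    2 ≤ (discSet (circleSignal (v i)) \ ⋃ j ≠ i, discSet (circleSignal (v j))).ncard := by
  set S := ⋃ j ≠ i, discSet (circleSignal (v j))
  have hS : S.Finite := Set.finite_iUnion fun j => Set.finite_iUnion fun _ =>
    finite_discSet_circleSignal _
  have h_avoid : ∀ᶠ r in 𝓝[>] (v i).2, r ∉ (fun x : Circle => ‖(x : ℂ) - (v i).1‖) '' S :=
    (nhdsWithin_mono _ fun _ => ne_of_gt).trans (nhdsNE_le_cofinite _)
      (hS.image _).eventually_cofinite_notMem
  obtain ⟨r, h_seq, h_avoid, hr⟩ :=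
    ((hv.eventually_seqRep_update i).and (h_avoid.and (Ioo_mem_nhdsGT h'))).exists
  have h_proper : Proper ((v i).1, r) := ⟨h.trans_lt hr.1, hr.2⟩
  have h_disc (p : ℂ × ℝ) :
      discSet (totalSignal (Function.update v i p)) = discSet (circleSignal p) ∪ S := by
    rw [discSet_totalSignal]
    refine (iSup_split_single _ i).trans (congr_arg₂ _ ?_ (Set.iUnion₂_congr fun j hj => ?_))
    · rw [Function.update_self]
    · rw [Function.update_of_ne hj]
  have h_disj : Disjoint (discSet (circleSignal ((v i).1, r))) S :=
    Set.disjoint_left.2 fun x hx hxS => h_avoid ⟨x, hxS, norm_eq_of_mem_discSet hx⟩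
  have h_length := congrArg Cycle.length h_seq
  rw [length_seqRep (piecewiseConst_totalSignal _), length_seqRep (piecewiseConst_totalSignal _),
    h_disc, Set.ncard_union_eq h_disj (finite_discSet_circleSignal _) hS, h_proper.ncard_discSet,
    ← Function.update_eq_self i v, h_disc, ← Set.sdiff_union_self] at h_length
  have := Set.ncard_union_le (discSet (circleSignal (v i)) \ S) S
  omega

lemma proper (hv : Robust v) {i : Fin n} (h : |1 - ‖(v i).1‖| ≤ (v i).2)
    (h' : (v i).2 < 1 + ‖(v i).1‖) : Proper (v i) := by
  refine ⟨h.lt_of_ne fun he => ?_, h'⟩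
  have h_nontrivial : (discSet (circleSignal (v i))).Nontrivial :=
    (Set.one_lt_ncard_iff_nontrivial_and_finite.1 (hv.two_le_ncard_sdiff i h h')).1.mono
      Set.sdiff_subset
  exact h_nontrivial.not_subsingleton (subsingleton_discSet_of_tangent he.symm h')

lemma pairwise_disjoint_discSet (hv : Robust v) :
    Pairwise fun i j => Disjoint (discSet (circleSignal (v i))) (discSet (circleSignal (v j))) := by
  intro i j hij
  rcases le_or_gt (1 + ‖(v i).1‖) (v i).2 with h' | h'
  · simp [discSet_circleSignal_eq_empty (Or.inl h')]
  rcases lt_or_ge (v i).2 |1 - ‖(v i).1‖| with h | h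
  · simp [discSet_circleSignal_eq_empty (Or.inr h)]
  have h_eq : discSet (circleSignal (v i)) \ ⋃ j ≠ i, discSet (circleSignal (v j)) =
      discSet (circleSignal (v i)) :=
    Set.eq_of_subset_of_ncard_le Set.sdiff_subset
      ((hv.proper h h').ncard_discSet.trans_le (hv.two_le_ncard_sdiff i h h'))
      (finite_discSet_circleSignal _)
  exact (sdiff_eq_left.1 h_eq).mono_right (Set.subset_iUnion₂_of_subset j hij.symm subset_rfl)

end Robust

/-! ### Superlevel sets -/

section Superlevel

variable {g : Circle → ℕ} {k : ℕ} {y : Circle}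

lemma HasSides.le_left_of_mem_connectedComponent {a b : {x : Circle // k ≤ g x}} {l r : ℕ}
    (hb : HasSides g b l r) (hy : g y < k) (hab : b ∈ connectedComponent a)
    (hlt : angleDiff y a < angleDiff y b) : k ≤ l := by
  have h_ne (x : {x : Circle // k ≤ g x}) : (x : Circle) ≠ y := fun hx => by
    have := x.2; rw [hx] at this; omega
  have h_image : IsPreconnected
      ((fun x : {x : Circle // k ≤ g x} => angleDiff y x) '' connectedComponent a) :=
    isPreconnected_connectedComponent.image _ fun x _ =>
      (ContinuousAt.comp (f := Subtype.val) (continuousAt_angleDiff (h_ne x))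
        continuous_subtype_val.continuousAt).continuousWithinAt
  obtain ⟨t, ht_left, ht_angle, ht⟩ := (hb.1.and ((eventually_angleDiff_mul_exp_left (h_ne b)).and
    (Ioo_mem_nhdsLT (sub_neg.2 hlt)))).exists
  obtain ⟨c, -, hc⟩ := h_image.Icc_subset ⟨a, mem_connectedComponent, rfl⟩ ⟨b, hab, rfl⟩
    (show angleDiff y (b * Circle.exp t) ∈ Set.Icc (angleDiff y a) (angleDiff y b) by
      rw [ht_angle]; constructor <;> linarith [ht.1, ht.2])
  rw [← ht_left, ← angleDiff_inj.1 hc]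
  exact c.2

variable {L R : Circle → ℕ}

lemma exists_superlevel_interval (hg : ∀ x, HasSides g x (L x) (R x))
    (hmax : ∀ x, g x = max (L x) (R x)) (hy : g y < k) {x : Circle} (hx : k ≤ g x) :
    ∃ p m, p ≤ m ∧ L (y * Circle.exp p) < k ∧ y * Circle.exp m = x ∧
      ∀ t ∈ Set.Icc p m, k ≤ g (y * Circle.exp t) := by
  set m := angleDiff y x
  have hm : y * Circle.exp m = x := mul_exp_angleDiff y x
  set S : Set ℝ := {t ∈ Set.Icc 0 m | g (y * Circle.exp t) < k}
  have hS : S.Nonempty := ⟨0, ⟨le_rfl, Circle.angleDiff_nonneg y x⟩, by simpa using hy⟩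
  have h_lub : IsLUB S (sSup S) := isLUB_csSup hS ⟨m, fun t ht => ht.1.2⟩
  set p := sSup S
  have hp : 0 ≤ p := hS.elim fun t ht => ht.1.1.trans (h_lub.1 ht)
  have hpm : p ≤ m := h_lub.2 fun t ht => ht.1.2
  have h_Ioc : ∀ t ∈ Set.Ioc p m, k ≤ g (y * Circle.exp t) := fun t ht => by
    by_contra! hlt
    exact (h_lub.1 ⟨⟨hp.trans ht.1.le, ht.2⟩, hlt⟩).not_gt ht.1
  have h_shift (t) : y * Circle.exp p * Circle.exp t = y * Circle.exp (p + t) := by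
    rw [Circle.exp_add, mul_assoc]
  have h_start : k ≤ g (y * Circle.exp p) := by
    rcases hpm.eq_or_lt with h | h
    · rwa [h, hm]
    · obtain ⟨t, ht_right, ht⟩ :=
        ((hg (y * Circle.exp p)).2.and (Ioo_mem_nhdsGT (sub_pos.2 h))).exists
      rw [hmax, ← ht_right, h_shift]
      exact (h_Ioc _ ⟨by linarith [ht.1], by linarith [ht.2]⟩).trans (le_max_right _ _)
  refine ⟨p, m, hpm, ?_, hm, fun t ht => ?_⟩
  · obtain ⟨q, hq : q < 0, h_left⟩ :=
      mem_nhdsLT_iff_exists_Ioo_subset.1 (hg (y * Circle.exp p)).1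
    obtain ⟨t, ht, hqt⟩ := exists_lt_of_lt_csSup hS (show p + q < p by linarith)
    have htp : t < p := (h_lub.1 ht).lt_of_ne fun h => (h ▸ ht.2).not_ge h_start
    have h_left_eq : g (y * Circle.exp p * Circle.exp (t - p)) = L (y * Circle.exp p) :=
      h_left ⟨by linarith, by linarith⟩
    rw [← h_left_eq, h_shift, add_sub_cancel]
    exact ht.2
  · rcases ht.1.eq_or_lt with rfl | hlt
    exacts [h_start, h_Ioc t ⟨hlt, ht.2⟩]

lemma card_connectedComponents_superlevel (hg : ∀ x, HasSides g x (L x) (R x))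
    (hmax : ∀ x, g x = max (L x) (R x)) (hy : g y < k) :
    Nat.card (ConnectedComponents {x : Circle // k ≤ g x}) = {a | L a < k ∧ k ≤ R a}.ncard := by
  have h_mem (a : {a | L a < k ∧ k ≤ R a}) : k ≤ g a := by
    rw [hmax]; exact a.2.2.trans (le_max_right _ _)
  symm
  refine Nat.card_eq_of_bijective (fun a : {a | L a < k ∧ k ≤ R a} =>
    ConnectedComponents.mk (⟨a, h_mem a⟩ : {x : Circle // k ≤ g x}))
    ⟨fun a b hab => ?_, fun c => ?_⟩
  · have hab : connectedComponent (⟨a, h_mem a⟩ : {x : Circle // k ≤ g x}) =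
        connectedComponent ⟨b, h_mem b⟩ := ConnectedComponents.coe_eq_coe.1 hab
    rcases lt_trichotomy (angleDiff y a) (angleDiff y b) with h | h | h
    · exact absurd ((hg b).le_left_of_mem_connectedComponent (a := ⟨a, h_mem a⟩)
        (b := ⟨b, h_mem b⟩) hy (by rw [hab]; exact mem_connectedComponent) h) b.2.1.not_ge
    · exact Subtype.ext (angleDiff_inj.1 h)
    · exact absurd ((hg a).le_left_of_mem_connectedComponent (a := ⟨b, h_mem b⟩)
        (b := ⟨a, h_mem a⟩) hy (by rw [← hab]; exact mem_connectedComponent) h) a.2.1.not_ge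
  · obtain ⟨⟨x, hx⟩, rfl⟩ := ConnectedComponents.surjective_coe c
    obtain ⟨p, m, hpm, h_left, rfl, h_le⟩ := exists_superlevel_interval hg hmax hy hx
    have h_right : k ≤ R (y * Circle.exp p) :=
      (le_max_iff.1 (hmax _ ▸ h_le p ⟨le_rfl, hpm⟩)).resolve_left h_left.not_ge
    refine ⟨⟨y * Circle.exp p, h_left, h_right⟩, ConnectedComponents.coe_eq_coe.2 ?_⟩
    let γ (t : Set.Icc p m) : {x : Circle // k ≤ g x} := ⟨y * Circle.exp t, h_le t t.2⟩
    have hγ : Continuous γ := Continuous.subtype_mk (by fun_prop) _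
    have := Subtype.preconnectedSpace (isPreconnected_Icc (a := p) (b := m))
    exact connectedComponent_eq ((isPreconnected_range hγ).subset_connectedComponent
      ⟨⟨p, le_rfl, hpm⟩, rfl⟩ ⟨⟨m, hpm, le_rfl⟩, rfl⟩)

end Superlevel

/-! ### Matchings -/

section Matching

variable {U D : Finset Circle}

/-- The number of signals seen at `x`, when the up-jumps `U` are matched by `σ` with the
down-jumps `D`, every matched pair bounds an arc, and `c` further signals cover the circle. -/
noncomputable def coverage (σ : U ≃ D) (c : ℕ) (x : Circle) : ℕ :=
  ∑ u : U, arc u (σ u) x + c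

/-- The collection of signals encoded by a matching `σ` and a number `c` of signals that cover
the circle. -/
noncomputable def arcSignals (σ : U ≃ D) (c : ℕ) : Multiset (Circle → ℕ) :=
  Finset.univ.val.map (fun u : U => arc u (σ u)) + Multiset.replicate c 1

lemma sum_arcSignals (σ : U ≃ D) (c : ℕ) : (arcSignals σ c).sum = coverage σ c := by
  funext x
  rw [arcSignals, Multiset.sum_add, Multiset.sum_replicate]
  exact congrArg₂ (· + ·) (Finset.sum_apply x Finset.univ fun u : U => arc u (σ u)) (mul_one c)

lemma coverage_le (σ : U ≃ D) (c : ℕ) (x : Circle) : coverage σ c x ≤ U.card + c := by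
  simpa [coverage] using
    Finset.sum_le_card_nsmul Finset.univ _ 1 fun (u : U) _ => arc_le_one u (σ u) x

open scoped Classical in
lemma sum_ite_eq_left (x : Circle) :
    ∑ u : U, (if x = u then 1 else 0) = if x ∈ U then 1 else 0 := by
  rw [Finset.sum_coe_sort U fun u => if x = u then 1 else 0, Finset.sum_ite_eq]

open scoped Classical in
lemma sum_ite_eq_right (σ : U ≃ D) (x : Circle) :
    ∑ u : U, (if x = σ u then 1 else 0) = if x ∈ D then 1 else 0 := by
  rw [σ.sum_comp fun d => if x = d then 1 else 0, sum_ite_eq_left]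

lemma coverage_pos_of_mem_left (σ : U ≃ D) (c : ℕ) {x : Circle} (hx : x ∈ U) :
    0 < coverage σ c x :=
  Nat.add_pos_left (Finset.sum_pos' (fun _ _ => Nat.zero_le _)
    ⟨⟨x, hx⟩, Finset.mem_univ _, by simp [arc_left]⟩) c

lemma coverage_pos_of_mem_right (σ : U ≃ D) (c : ℕ) {x : Circle} (hx : x ∈ D) :
    0 < coverage σ c x :=
  Nat.add_pos_left (Finset.sum_pos' (fun _ _ => Nat.zero_le _)
    ⟨σ.symm ⟨x, hx⟩, Finset.mem_univ _, by simp [arc_right]⟩) c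

lemma ne_of_disjoint (hUD : Disjoint U D) (u : U) (d : D) : (u : Circle) ≠ d :=
  fun h => Finset.disjoint_left.1 hUD u.2 (h ▸ d.2)

open scoped Classical in
lemma hasSides_coverage (hUD : Disjoint U D) (σ : U ≃ D) (c : ℕ) (x : Circle) :
    HasSides (coverage σ c) x (coverage σ c x - if x ∈ U then 1 else 0)
      (coverage σ c x - if x ∈ D then 1 else 0) := by
  have h_left (u : U) : (if x = u then 1 else 0) ≤ arc u (σ u) x := by
    split_ifs with h
    exacts [by rw [h, arc_left], Nat.zero_le _]
  have h_right (u : U) : (if x = σ u then 1 else 0) ≤ arc u (σ u) x := by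
    split_ifs with h
    exacts [by rw [h, arc_right], Nat.zero_le _]
  have h := (HasSides.sum fun (u : U) (_ : u ∈ Finset.univ) =>
    hasSides_arc (ne_of_disjoint hUD u (σ u)) x).add (.const c x)
  rw [Finset.sum_tsub_distrib _ fun u _ => h_left u,
    Finset.sum_tsub_distrib _ fun u _ => h_right u] at h
  rw [← sum_ite_eq_left, ← sum_ite_eq_right σ, coverage,
    Nat.sub_add_comm (Finset.sum_le_sum fun u _ => h_left u),
    Nat.sub_add_comm (Finset.sum_le_sum fun u _ => h_right u)]
  exact h

/-- Both coverages have the same jumps, so their difference is locally constant. -/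
lemma coverage_add_coverage (hUD : Disjoint U D) (σ τ : U ≃ D) (c d : ℕ) (x y : Circle) :
    coverage σ c x + coverage τ d y = coverage τ d x + coverage σ c y := by
  classical
  have h_const : IsLocallyConstant fun x => (coverage σ c x : ℤ) - coverage τ d x := by
    refine (IsLocallyConstant.iff_eventually_eq _).2 fun x =>
      eventually_nhds_circle.2 ⟨rfl, ?_, ?_⟩
    · filter_upwards [(hasSides_coverage hUD σ c x).1, (hasSides_coverage hUD τ d x).1]
        with t hσ hτ
      rw [hσ, hτ]
      split_ifs with h
      · have := coverage_pos_of_mem_left σ c h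
        have := coverage_pos_of_mem_left τ d h
        omega
      · rfl
    · filter_upwards [(hasSides_coverage hUD σ c x).2, (hasSides_coverage hUD τ d x).2]
        with t hσ hτ
      rw [hσ, hτ]
      split_ifs with h
      · have := coverage_pos_of_mem_right σ c h
        have := coverage_pos_of_mem_right τ d h
        omega
      · rfl
  have := h_const.apply_eq_of_preconnectedSpace x y
  omega

lemma arc_ne_zero (a b : Circle) : arc a b ≠ 0 := fun h => by
  simpa [arc_left] using congrFun h a

lemma arc_ne_one {a b : Circle} (hab : a ≠ b) : arc a b ≠ 1 := fun h => by
  have h_disc := discSet_arc hab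
  have : discSet 1 = ∅ := Set.eq_empty_of_forall_notMem fun x hx => hx continuousAt_const
  rw [h, this] at h_disc
  exact (Set.insert_nonempty _ _).ne_empty h_disc.symm

lemma ne_zero_of_mem_arcSignals {σ : U ≃ D} {c : ℕ} {g : Circle → ℕ} (hg : g ∈ arcSignals σ c) :
    g ≠ 0 := by
  rcases Multiset.mem_add.1 hg with hg | hg
  · obtain ⟨u, -, rfl⟩ := Multiset.mem_map.1 hg
    exact arc_ne_zero _ _
  · exact Multiset.eq_of_mem_replicate hg ▸ one_ne_zero

lemma arcSignals_injective (hUD : Disjoint U D) {σ τ : U ≃ D} {c d : ℕ}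
    (h : arcSignals σ c = arcSignals τ d) : σ = τ := by
  ext u
  have h_mem : arc u (σ u) ∈ arcSignals τ d :=
    h ▸ Multiset.mem_add.2 (.inl (Multiset.mem_map_of_mem _ (Finset.mem_univ u)))
  rcases Multiset.mem_add.1 h_mem with h_mem | h_mem
  · obtain ⟨u', -, h_arc⟩ := Multiset.mem_map.1 h_mem
    obtain ⟨hu, h_image⟩ :=
      (arc_inj (ne_of_disjoint hUD _ _) (ne_of_disjoint hUD _ _)).1 h_arc
    rw [← h_image, Subtype.ext hu]
  · exact absurd (Multiset.eq_of_mem_replicate h_mem) (arc_ne_one (ne_of_disjoint hUD _ _))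

end Matching

section Realization

variable {n : ℕ} {v : Fin n → ℂ × ℝ}

lemma sum_activeSignals (v : Fin n → ℂ × ℝ) : (activeSignals v).sum = totalSignal v := by
  classical
  have h_inactive : (Multiset.filter (fun g => ¬ g ≠ 0)
      (Finset.univ.val.map fun i => circleSignal (v i))).sum = 0 :=
    Multiset.sum_eq_zero fun g hg => not_not.1 (Multiset.mem_filter.1 hg).2
  funext x
  rw [← add_zero (activeSignals v).sum, ← h_inactive, activeSignals, ← Multiset.sum_add,
    Multiset.filter_add_not, totalSignal]
  exact Finset.sum_apply x Finset.univ fun i => circleSignal (v i)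

lemma Robust.activeSignals_eq [DecidablePred fun i => Proper (v i)] (hv : Robust v) :
    ∃ c, activeSignals v = (Finset.univ.filter fun i => Proper (v i)).val.map
      (fun i => circleSignal (v i)) + Multiset.replicate c 1 := by
  classical
  set J := Finset.univ.filter fun i => 1 + ‖(v i).1‖ ≤ (v i).2
  have h_disj : Disjoint (Finset.univ.filter fun i => Proper (v i)) J :=
    Finset.disjoint_filter.2 fun i _ hi => hi.2.not_ge
  have h_active : Finset.univ.filter (fun i => circleSignal (v i) ≠ 0) =
      (Finset.univ.filter fun i => Proper (v i)).disjUnion J h_disj := by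
    ext i
    simp only [Finset.mem_filter_univ, Finset.mem_disjUnion, J]
    constructor
    · intro h
      by_contra! h'
      exact h (circleSignal_eq_zero (lt_of_not_ge fun h'' => h'.1 (hv.proper h'' h'.2)))
    · rintro (h | h)
      · obtain ⟨a, b, -, h_arc⟩ := h.exists_arc
        exact h_arc ▸ arc_ne_zero a b
      · exact circleSignal_eq_one h ▸ one_ne_zero
  refine ⟨J.card, ?_⟩
  calc activeSignals v
      = (Finset.univ.filter fun i => circleSignal (v i) ≠ 0).val.map
          fun i => circleSignal (v i) := by rw [activeSignals, Multiset.filter_map]; rfl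
    _ = _ := by
      rw [h_active, Finset.disjUnion_val, Multiset.map_add, Multiset.map_congr rfl fun i hi =>
        circleSignal_eq_one (Finset.mem_filter.1 hi).2, Multiset.map_const']; rfl

lemma exists_matching {E : Type*} [Fintype E] {a b : E → Circle} (ha : Function.Injective a)
    (hb : Function.Injective b) (hab : ∀ i j, a i ≠ b j) :
    ∃ U D : Finset Circle, Disjoint U D ∧ ∃ σ : U ≃ D, ∀ c, arcSignals σ c =
      Finset.univ.val.map (fun i => arc (a i) (b i)) + Multiset.replicate c 1 := by
  let e {f : E → Circle} (hf : Function.Injective f) : E ≃ Finset.univ.map ⟨f, hf⟩ :=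
    (Equiv.ofInjective f hf).trans (Equiv.subtypeEquivRight (by simp))
  refine ⟨Finset.univ.map ⟨a, ha⟩, Finset.univ.map ⟨b, hb⟩, ?_, (e ha).symm.trans (e hb),
    fun c => ?_⟩
  · rw [Finset.disjoint_left]
    simpa using fun i j => (hab i j).symm
  · rw [arcSignals, ← Finset.map_univ_equiv (e ha), Finset.map_val, Multiset.map_map]
    refine congrArg₂ _ (Multiset.map_congr rfl fun i _ => ?_) rfl
    simp only [Function.comp_apply, Equiv.coe_toEmbedding, Equiv.trans_apply,
      Equiv.symm_apply_apply]
    rfl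

lemma Robust.exists_arcSignals (hv : Robust v) : ∃ U D : Finset Circle, Disjoint U D ∧
    ∃ (σ : U ≃ D) (c : ℕ), activeSignals v = arcSignals σ c := by
  classical
  obtain ⟨c, hc⟩ := hv.activeSignals_eq
  set I := Finset.univ.filter fun i => Proper (v i)
  choose a b hab h_arc using fun i : I => (Finset.mem_filter.1 i.2).2.exists_arc
  have h_disc (i : I) : discSet (circleSignal (v i)) = {a i, b i} := by
    rw [h_arc, discSet_arc (hab i)]
  have h_eq {i j : I} {x : Circle} (hi : x ∈ discSet (circleSignal (v i)))
      (hj : x ∈ discSet (circleSignal (v j))) : i = j := Subtype.ext <| by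
    by_contra hij
    exact Set.disjoint_left.1 (hv.pairwise_disjoint_discSet hij) hi hj
  have ha (i : I) : a i ∈ discSet (circleSignal (v i)) := by simp [h_disc]
  have hb (i : I) : b i ∈ discSet (circleSignal (v i)) := by simp [h_disc]
  obtain ⟨U, D, hUD, σ, hσ⟩ := exists_matching (a := a) (b := b)
    (fun i j h => h_eq (ha i) (h ▸ ha j)) (fun i j h => h_eq (hb i) (h ▸ hb j))
    fun i j h => hab j (h_eq (ha i) (h ▸ hb j) ▸ h)
  refine ⟨U, D, hUD, σ, c, ?_⟩
  rw [hc, hσ, ← Multiset.attach_map_val' I.val]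
  exact congrArg₂ _ (Multiset.map_congr rfl fun i _ => h_arc i) rfl

lemma exists_robust_activeSignals_eq {U D : Finset Circle} (hUD : Disjoint U D) (σ : U ≃ D)
    (c : ℕ) : ∃ (n : ℕ) (v : Fin n → ℂ × ℝ), Robust v ∧ activeSignals v = arcSignals σ c := by
  classical
  choose p hp hp_arc using fun u => exists_proper_of_ne (ne_of_disjoint hUD u (σ u))
  have h_full : 1 + ‖((0 : ℂ), (2 : ℝ)).1‖ < ((0 : ℂ), (2 : ℝ)).2 := by norm_num
  let w : U ⊕ Fin c → ℂ × ℝ := Sum.elim p fun _ => (0, 2)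
  have h_empty (i : Fin c) : discSet (circleSignal (w (.inr i))) = ∅ :=
    discSet_circleSignal_eq_empty (.inl h_full.le)
  have h_disj : Pairwise fun i j =>
      Disjoint (discSet (circleSignal (w i))) (discSet (circleSignal (w j))) := by
    rintro (u | i) (u' | j) hij
    · have hu : u' ≠ u := fun h => hij (h ▸ rfl)
      simp only [w, Sum.elim_inl, hp_arc, discSet_arc (ne_of_disjoint hUD _ _)]
      simp [ne_of_disjoint hUD, (ne_of_disjoint hUD _ _).symm, hu]
    · simp [h_empty]
    · simp [h_empty]
    · simp [h_empty]
  have h_stable : ∀ i, Stable (w i) := Sum.rec (fun u => .inl (hp u)) fun _ => .inr h_full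
  let e : Fin (Fintype.card (U ⊕ Fin c)) ≃ U ⊕ Fin c := (Fintype.equivFin _).symm
  refine ⟨_, w ∘ e, robust_of_stable (fun i => h_stable _)
    (fun i j hij => h_disj (e.injective.ne hij)), ?_⟩
  have h_map : (Finset.univ.val.map fun i => circleSignal ((w ∘ e) i)) = arcSignals σ c :=
    calc Finset.univ.val.map (fun i => circleSignal ((w ∘ e) i))
        = Finset.univ.val.map (fun i => circleSignal (w i)) := by
          rw [← Finset.map_univ_equiv e, Finset.map_val, Multiset.map_map]; rfl
      _ = arcSignals σ c := by
          rw [← Finset.univ_disjSum_univ, Finset.val_disjSum, Multiset.disjSum, Multiset.map_add,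
            Multiset.map_map, Multiset.map_map, arcSignals]
          exact congrArg₂ _ (Multiset.map_congr rfl fun u _ => hp_arc u)
            (Multiset.eq_replicate.2 ⟨by simp, by simp [w, circleSignal_eq_one h_full.le]⟩)
  rw [activeSignals, h_map, Multiset.filter_eq_self]
  exact fun g => ne_zero_of_mem_arcSignals

lemma mem_robustDecomps_iff {f : Circle → ℕ} {M : Multiset (Circle → ℕ)} :
    M ∈ robustDecomps f ↔ ∃ U D : Finset Circle, Disjoint U D ∧
      ∃ (σ : U ≃ D) (c : ℕ), coverage σ c ∈ modFinite f ∧ arcSignals σ c = M := by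
  constructor
  · rintro ⟨n, v, hf, hv, rfl⟩
    obtain ⟨U, D, hUD, σ, c, h⟩ := hv.exists_arcSignals
    exact ⟨U, D, hUD, σ, c, by rwa [← sum_arcSignals, ← h, sum_activeSignals], h.symm⟩
  · rintro ⟨U, D, hUD, σ, c, hf, rfl⟩
    obtain ⟨n, v, hv, h⟩ := exists_robust_activeSignals_eq hUD σ c
    exact ⟨n, v, by rwa [← sum_activeSignals, h, sum_arcSignals], hv, h⟩

end Realization

/-- The points at which a function jumps up, in counterclockwise direction. -/
def upJumps (f : Circle → ℕ) : Set Circle := {x | limMinus f x < limPlus f x}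

/-- The points at which a function jumps down, in counterclockwise direction. -/
def downJumps (f : Circle → ℕ) : Set Circle := {x | limPlus f x < limMinus f x}

lemma lower_le_canon (f : Circle → ℕ) (x : Circle) : lower f ≤ canon f x :=
  Nat.sInf_le ⟨x, rfl⟩

lemma exists_canon_eq_lower (f : Circle → ℕ) : ∃ x, canon f x = lower f :=
  Nat.sInf_mem (Set.range_nonempty (canon f))

section Jumps

variable {U D : Finset Circle} {σ : U ≃ D} {c : ℕ} {f : Circle → ℕ}

open scoped Classical in
lemma coverage_eq_max (hUD : Disjoint U D) (σ : U ≃ D) (c : ℕ) (x : Circle) :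
    coverage σ c x = max (coverage σ c x - if x ∈ U then 1 else 0)
      (coverage σ c x - if x ∈ D then 1 else 0) := by
  by_cases hU : x ∈ U
  · rw [if_pos hU, if_neg (Finset.disjoint_left.1 hUD hU)]; omega
  · rw [if_neg hU]; omega

lemma canon_eq_coverage (hUD : Disjoint U D) (hf : coverage σ c ∈ modFinite f) :
    canon f = coverage σ c := by
  classical
  funext x
  have h := (hasSides_coverage hUD σ c x).of_finite_ne hf
  rw [canon, h.limPlus_eq, h.limMinus_eq, max_comm, ← coverage_eq_max hUD]

lemma upJumps_eq (hUD : Disjoint U D) (hf : coverage σ c ∈ modFinite f) : upJumps f = U := by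
  classical
  ext x
  have h := (hasSides_coverage hUD σ c x).of_finite_ne hf
  have h_pos := coverage_pos_of_mem_left σ c (x := x)
  have h_disj : x ∈ U → x ∉ D := (Finset.disjoint_left.1 hUD ·)
  rw [upJumps, Set.mem_ofPred_eq, h.limPlus_eq, h.limMinus_eq, Finset.mem_coe]
  grind

lemma downJumps_eq (hUD : Disjoint U D) (hf : coverage σ c ∈ modFinite f) : downJumps f = D := by
  classical
  ext x
  have h := (hasSides_coverage hUD σ c x).of_finite_ne hf
  have h_pos := coverage_pos_of_mem_right σ c (x := x)
  have h_disj : x ∈ U → x ∉ D := (Finset.disjoint_left.1 hUD ·)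
  rw [downJumps, Set.mem_ofPred_eq, h.limPlus_eq, h.limMinus_eq, Finset.mem_coe]
  grind

lemma canon_le_upper (hUD : Disjoint U D) (hf : coverage σ c ∈ modFinite f) (x : Circle) :
    canon f x ≤ upper f :=
  le_csSup ⟨U.card + c, by
    rintro _ ⟨y, rfl⟩
    exact canon_eq_coverage hUD hf ▸ coverage_le σ c y⟩ ⟨x, rfl⟩

lemma exists_canon_eq_upper (hUD : Disjoint U D) (hf : coverage σ c ∈ modFinite f) :
    ∃ x, canon f x = upper f :=
  Nat.sSup_mem (Set.range_nonempty (canon f)) ⟨upper f, by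
    rintro _ ⟨y, rfl⟩
    exact canon_le_upper hUD hf y⟩

open scoped Classical in
lemma card_connectedComponents_canon (hUD : Disjoint U D) (hf : coverage σ c ∈ modFinite f)
    {k : ℕ} (hk : lower f < k) : Nat.card (ConnectedComponents {x : Circle // k ≤ canon f x}) =
      (U.filter fun x => canon f x = k).card := by
  obtain ⟨y, hy⟩ := exists_canon_eq_lower f
  rw [canon_eq_coverage hUD hf] at hy ⊢
  rw [card_connectedComponents_superlevel (hasSides_coverage hUD σ c) (coverage_eq_max hUD σ c)
    (hy.trans_lt hk), ← Set.ncard_coe_finset]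
  congr 1
  ext a
  have h_disj : a ∈ U → a ∉ D := (Finset.disjoint_left.1 hUD ·)
  rw [Set.mem_ofPred_eq, Finset.mem_coe, Finset.mem_filter]
  grind

open scoped Classical in
lemma card_filter_canon_pos (hUD : Disjoint U D) (hf : coverage σ c ∈ modFinite f) {k : ℕ}
    (hk : lower f < k) (hk' : k ≤ upper f) : 0 < (U.filter fun x => canon f x = k).card := by
  obtain ⟨y, hy⟩ := exists_canon_eq_lower f
  obtain ⟨x, hx⟩ := exists_canon_eq_upper hUD hf
  rw [canon_eq_coverage hUD hf] at hx hy ⊢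
  obtain ⟨p, m, hpm, h_left, -, h_le⟩ := exists_superlevel_interval (hasSides_coverage hUD σ c)
    (coverage_eq_max hUD σ c) (hy.trans_lt hk) (hk'.trans_eq hx.symm)
  have h_start := h_le p ⟨le_rfl, hpm⟩
  refine Finset.card_pos.2 ⟨y * Circle.exp p, Finset.mem_filter.2 ?_⟩
  grind

lemma lower_lt_canon_of_mem (hUD : Disjoint U D) (hf : coverage σ c ∈ modFinite f) {x : Circle}
    (hx : x ∈ U) : lower f < canon f x := by
  classical
  obtain ⟨t, ht⟩ := (hasSides_coverage hUD σ c x).1.exists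
  have h_lower := lower_le_canon f (x * Circle.exp t)
  have h_pos := coverage_pos_of_mem_left σ c hx
  rw [canon_eq_coverage hUD hf] at h_lower ⊢
  rw [if_pos hx] at ht
  omega

/-- Every component of a superlevel set starts at an up-jump, so the components over all levels
are as many as the up-jumps. -/
lemma card_eq_upper_sub_lower_add_tau (hUD : Disjoint U D) (hf : coverage σ c ∈ modFinite f) :
    U.card = upper f - lower f + tau f := by
  classical
  calc U.card = ∑ k ∈ Finset.Icc (lower f + 1) (upper f), (U.filter fun x => canon f x = k).card :=
        Finset.card_eq_sum_card_fiberwise fun x hx => Finset.mem_coe.2 <|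
          Finset.mem_Icc.2 ⟨lower_lt_canon_of_mem hUD hf hx, canon_le_upper hUD hf x⟩
    _ = ∑ k ∈ Finset.Icc (lower f + 1) (upper f),
        (1 + (Nat.card (ConnectedComponents {x : Circle // k ≤ canon f x}) - 1)) :=
      Finset.sum_congr rfl fun k hk => by
        obtain ⟨hk, hk'⟩ := Finset.mem_Icc.1 hk
        rw [card_connectedComponents_canon hUD hf hk,
          Nat.add_sub_cancel' (card_filter_canon_pos hUD hf hk hk')]
    _ = upper f - lower f + tau f := by simp [Finset.sum_add_distrib, tau]

lemma exists_coverage_mem_modFinite (hUD : Disjoint U D) (hf : coverage σ c ∈ modFinite f)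
    (hτ : tau f ≤ lower f) (ρ : U ≃ D) : ∃ d, coverage ρ d ∈ modFinite f := by
  obtain ⟨x₀, hx₀⟩ := exists_canon_eq_lower f
  obtain ⟨x₁, hx₁⟩ := exists_canon_eq_upper hUD hf
  have h_le := canon_le_upper hUD hf x₀
  rw [canon_eq_coverage hUD hf] at hx₀ hx₁ h_le
  have h_base : coverage ρ 0 x₀ ≤ lower f := by
    have h_exchange := coverage_add_coverage hUD ρ σ 0 c x₁ x₀
    have h_card := coverage_le ρ 0 x₁
    rw [card_eq_upper_sub_lower_add_tau hUD hf] at h_card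
    omega
  refine ⟨lower f - coverage ρ 0 x₀, ?_⟩
  convert hf using 1
  funext x
  have h_exchange := coverage_add_coverage hUD ρ σ 0 c x x₀
  have h_add : coverage ρ (lower f - coverage ρ 0 x₀) x =
      coverage ρ 0 x + (lower f - coverage ρ 0 x₀) := rfl
  omega

lemma robustDecomps_eq_range (hUD : Disjoint U D) (hf : coverage σ c ∈ modFinite f)
    {d : (U ≃ D) → ℕ} (hd : ∀ ρ, coverage ρ (d ρ) ∈ modFinite f) :
    robustDecomps f = Set.range fun ρ => arcSignals ρ (d ρ) := by
  ext M
  rw [mem_robustDecomps_iff]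
  constructor
  · rintro ⟨U', D', hUD', ρ, d', h, rfl⟩
    obtain rfl : U' = U :=
      Finset.coe_injective ((upJumps_eq hUD' h).symm.trans (upJumps_eq hUD hf))
    obtain rfl : D' = D :=
      Finset.coe_injective ((downJumps_eq hUD' h).symm.trans (downJumps_eq hUD hf))
    have h_eq : coverage ρ (d ρ) = coverage ρ d' :=
      (canon_eq_coverage hUD (hd ρ)).symm.trans (canon_eq_coverage hUD h)
    exact ⟨ρ, congrArg (arcSignals ρ) (Nat.add_left_cancel (congrFun h_eq 1))⟩
  · rintro ⟨ρ, rfl⟩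
    exact ⟨U, D, hUD, ρ, d ρ, hd ρ, rfl⟩

end Jumps

end CircleDecomp

open CircleDecomp

theorem proposition6p3 (f : Circle → ℕ) (hf : CircleDecomp.PiecewiseConst f)
    (hex : ∃ (n : ℕ) (v : Fin n → ℂ × ℝ),
      CircleDecomp.totalSignal v ∈ CircleDecomp.modFinite f ∧ CircleDecomp.Robust v)
    (hτ : CircleDecomp.tau f ≤ CircleDecomp.lower f) :
    (CircleDecomp.robustDecomps f).ncard =
      Nat.factorial (CircleDecomp.upper f - CircleDecomp.lower f + CircleDecomp.tau f) := by
  classical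
  obtain ⟨n, v, hv_mem, hv⟩ := hex
  obtain ⟨U, D, hUD, σ, c, h_mem, -⟩ := mem_robustDecomps_iff.1 ⟨n, v, hv_mem, hv, rfl⟩
  choose d hd using exists_coverage_mem_modFinite hUD h_mem hτ
  rw [robustDecomps_eq_range hUD h_mem hd,
    Set.ncard_range_of_injective fun ρ ρ' h => arcSignals_injective hUD h,
    Nat.card_eq_fintype_card, Fintype.card_equiv σ, Fintype.card_coe,
    card_eq_upper_sub_lower_add_tau hUD h_mem]
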